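/- Let $d\neq 1$ be a square-free integer, let $K=\mathbb{Q}(\sqrt d)$ with ring of integers $\mathcal{O}_K$, and let $H$ be the group of upper unitriangular $3\times 3$ matrices with entries in $\mathcal{O}_K$. Two irreducible finite-dimensional complex representations $\rho,\sigma$ of $H$ are twist equivalent if $\sigma\cong\chi\otimes\rho$ for some homomorphism $\chi:H\to\mathbb{C}^\times$; the equivalence classes are called twist isoclasses, and $r_n(H)$ denotes the number of twist isoclasses of irreducible representations of dimension $n$. For a prime $p$ consider the congruence $$x^2-d\equiv 0 \pmod p\ \text{ if } d\equiv 2,3 \ (\mathrm{mod}\ 4),\qquad x^2-x-\tfrac{d-1}{4}\equiv 0\pmod p\ \text{ if } d\equiv 1\ (\mathrm{mod}\ 4);$$ $p$ is called inert, split or ramified if it has respectively $0$, $2$ or $1$ solutions modulo $p$. Then all the numbers $r_n(H)$ are finite, and the following hold. (1) For every prime $p$ and every $s\in\mathbb{C}$ with $\operatorname{Re}(s)>1$, the $p$-local representation growth zeta function $\zeta_H^p(s)=\sum_{n\ge 0} r_{p^n}(H)\,p^{-ns}$ converges absolutely and $$\zeta_H^p(s)=\begin{cases}\dfrac{1-p^{-2s}}{1-p^{2-2s}}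 & \text{if } p \text{ is inert},\\[2ex] \left(\dfrac{1-p^{-s}}{1-p^{1-s}}\right)^2 & \text{if } p \text{ splits},\\[2ex] \dfrac{1-p^{-s}}{1-p^{1-s}} & \text{if } p \text{ is ramified}.\end{cases}$$ (2) For every $s\in\mathbb{C}$ with $\operatorname{Re}(s)>2$, the representation growth zeta function $\zeta_H(s)=\sum_{n\ge 1} r_n(H)\,n^{-s}$ converges absolutely, $\zeta^{\mathbf D}_K(s)\neq 0$, and $$\zeta_H(s)=\frac{\zeta^{\mathbf D}_K(s-1)}{\zeta^{\mathbf D}_K(s)},$$ where $\zeta^{\mathbf D}_K(s)=\sum_{0\ne I\subseteq\mathcal{O}_K}N(I)^{-s}$ is the Dedekind zeta function of $K$. -/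

import Mathlib

namespace HeisenbergZeta

/-- The Heisenberg group over `R`: upper unitriangular `3 × 3` matrices with entries in `R`
(such matrices have determinant `1`). -/
def heisenberg (R : Type*) [CommRing R] : Subgroup (Matrix.SpecialLinearGroup (Fin 3) R) where
  carrier := {g | (∀ i, g i i = 1) ∧ ∀ i j, j < i → g i j = 0}
  one_mem' := by
    refine ⟨fun i => by simp, fun i j hij => ?_⟩
    simp [hij.ne']
  mul_mem' := by
    rintro a b ⟨ha, ha'⟩ ⟨hb, hb'⟩
    have a1 := ha' 1 0 (by decide)
    have a2 := ha' 2 0 (by decide)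
    have a3 := ha' 2 1 (by decide)
    have b1 := hb' 1 0 (by decide)
    have b2 := hb' 2 0 (by decide)
    have b3 := hb' 2 1 (by decide)
    refine ⟨fun i => ?_, fun i j hij => ?_⟩
    · fin_cases i <;> simp [Matrix.mul_apply, Fin.sum_univ_three, *]
    · fin_cases i <;> fin_cases j <;> first
        | exact absurd hij (by decide)
        | simp [Matrix.mul_apply, Fin.sum_univ_three, *]
  inv_mem' := by
    rintro a ⟨ha, ha'⟩
    have a1 := ha' 1 0 (by decide)
    have a2 := ha' 2 0 (by decide)
    have a3 := ha' 2 1 (by decide)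
    refine ⟨fun i => ?_, fun i j hij => ?_⟩
    · fin_cases i <;>
        simp [Matrix.SpecialLinearGroup.coe_inv, Matrix.adjugate_fin_three, *]
    · fin_cases i <;> fin_cases j <;> first
        | exact absurd hij (by decide)
        | simp [Matrix.SpecialLinearGroup.coe_inv, Matrix.adjugate_fin_three, *]

section Twist

variable {G : Type*} [Group G] {V W : Type*} [AddCommGroup V] [Module ℂ V]
  [AddCommGroup W] [Module ℂ W]

/-- The twist `χ ρ` of a complex representation `ρ` by a one-dimensional representation `χ`. -/
def twist (χ : G →* ℂˣ) (ρ : Representation ℂ G V) : Representation ℂ G V where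
  toFun g := (χ g : ℂ) • ρ g
  map_one' := by simp
  map_mul' g h := by
    ext v
    simp [mul_smul, smul_comm (χ g : ℂ) (χ h : ℂ)]

/-- Twist equivalence: `χ ρ` is isomorphic to `σ` for some one-dimensional representation `χ`. -/
def TwistEquivalent (ρ : Representation ℂ G V) (σ : Representation ℂ G W) : Prop :=
  ∃ χ : G →* ℂˣ, Nonempty ((twist χ ρ).Equiv σ)

end Twist

/-- The irreducible complex representations of `G` of dimension `n`, realised on `ℂⁿ`. -/
abbrev IrrRep (G : Type*) [Group G] (n : ℕ) : Type _ :=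
  {ρ : Representation ℂ G (Fin n → ℂ) // ρ.IsIrreducible}

/-- Twist equivalence as an equivalence relation on the `n`-dimensional irreducible
representations. -/
def twistSetoid (G : Type*) [Group G] (n : ℕ) : Setoid (IrrRep G n) where
  r ρ σ := TwistEquivalent ρ.1 σ.1
  iseqv := by
    refine ⟨fun ρ => ⟨1, ⟨.mk (LinearEquiv.refl ℂ _) fun g => ?_⟩⟩, ?_, ?_⟩
    · ext; simp [twist]
    · rintro ρ σ ⟨χ, ⟨e⟩⟩
      refine ⟨χ⁻¹, ⟨.mk e.toLinearEquiv.symm fun g => ?_⟩⟩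
      apply LinearMap.ext
      intro v
      apply e.toLinearEquiv.injective
      have h' : e.toLinearEquiv ((χ g : ℂ) • ρ.1 g (e.toLinearEquiv.symm v))
          = σ.1 g (e.toLinearEquiv (e.toLinearEquiv.symm v)) :=
        LinearMap.congr_fun (e.toIntertwiningMap.isIntertwining' g) (e.toLinearEquiv.symm v)
      rw [LinearEquiv.apply_symm_apply, map_smul] at h'
      change e.toLinearEquiv (e.toLinearEquiv.symm (((χ g)⁻¹ : ℂˣ) • σ.1 g v))
        = e.toLinearEquiv (ρ.1 g (e.toLinearEquiv.symm v))
      rw [LinearEquiv.apply_symm_apply, ← h']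
      exact inv_smul_smul (χ g) _
    · rintro ρ σ τ ⟨χ, ⟨e⟩⟩ ⟨ψ, ⟨f⟩⟩
      refine ⟨ψ * χ, ⟨.mk (e.toLinearEquiv.trans f.toLinearEquiv) fun g => ?_⟩⟩
      apply LinearMap.ext
      intro v
      have h : e.toLinearEquiv ((χ g : ℂ) • ρ.1 g v) = σ.1 g (e.toLinearEquiv v) :=
        LinearMap.congr_fun (e.toIntertwiningMap.isIntertwining' g) v
      have h' : f.toLinearEquiv ((ψ g : ℂ) • σ.1 g (e.toLinearEquiv v))
          = τ.1 g (f.toLinearEquiv (e.toLinearEquiv v)) :=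
        LinearMap.congr_fun (f.toIntertwiningMap.isIntertwining' g) (e.toLinearEquiv v)
      have key : f.toLinearEquiv (e.toLinearEquiv (((ψ g : ℂ) * (χ g : ℂ)) • ρ.1 g v))
          = τ.1 g (f.toLinearEquiv (e.toLinearEquiv v)) := by
        rw [← h', ← h, mul_smul, map_smul]
      simpa [twist] using key

/-- The twist isoclasses of `n`-dimensional irreducible representations of `G`. -/
abbrev TwistIsoclass (G : Type*) [Group G] (n : ℕ) : Type _ := Quotient (twistSetoid G n)

/-- `r_n(G)`, the number of twist isoclasses of dimension `n`. -/
noncomputable def numTwistIsoclasses (G : Type*) [Group G] (n : ℕ) : ℕ :=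
  Nat.card (TwistIsoclass G n)

/-- The representation growth zeta function `∑ r_n(G) n^{-s}`. -/
noncomputable def repZeta (G : Type*) [Group G] (s : ℂ) : ℂ :=
  LSeries (fun n => (numTwistIsoclasses G n : ℂ)) s

/-- The `n`-th term `r_{p^n}(G) p^{-ns}` of the `p`-local representation growth zeta function. -/
noncomputable def localTerm (G : Type*) [Group G] (p : ℕ) (s : ℂ) (n : ℕ) : ℂ :=
  (numTwistIsoclasses G (p ^ n) : ℂ) * (p : ℂ) ^ (-(n : ℂ) * s)

/-- The `p`-local representation growth zeta function `∑ r_{p^n}(G) p^{-ns}`. -/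
noncomputable def localRepZeta (G : Type*) [Group G] (p : ℕ) (s : ℂ) : ℂ :=
  ∑' n : ℕ, localTerm G p s n

/-- The number of solutions modulo `p` of `x² - x - (d-1)/4 ≡ 0` if `d ≡ 1 mod 4`, and of
`x² - d ≡ 0` otherwise. -/
noncomputable def numSolutions (d : ℤ) (p : ℕ) : ℕ :=
  if d % 4 = 1 then Nat.card {x : ZMod p // x ^ 2 - x - (((d - 1) / 4 : ℤ) : ZMod p) = 0}
  else Nat.card {x : ZMod p // x ^ 2 - (d : ZMod p) = 0}

/-- `p` is inert in `ℚ(√d)`. -/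
def IsInert (d : ℤ) (p : ℕ) : Prop := numSolutions d p = 0

/-- `p` splits in `ℚ(√d)`. -/
def Splits (d : ℤ) (p : ℕ) : Prop := numSolutions d p = 2

/-- `p` is ramified in `ℚ(√d)`. -/
def IsRamified (d : ℤ) (p : ℕ) : Prop := numSolutions d p = 1

end HeisenbergZeta

/-! This is the Stone–von Neumann principle over `𝓞 K`. In an irreducible representation the corner
entries act through an additive character `ψ` of `𝓞 K`. Twisting does not change `ψ`, because the
corner elements are commutators. The commutator pairing `(a, b) ↦ ψ (a b)` degenerates exactly on
`conductor ψ`. After a twist, the group acts on functions on `𝓞 K ⧸ conductor ψ` by translations and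
multiplications by characters. These models are irreducible (`schrodinger_irreducible`), exhaust all
representations up to twist (`exists_twistEquivalent_schrodinger`), and are separated by `ψ`
(`schrodinger_twist_injective`). Hence `r_n` counts the characters whose conductor has norm `n`.

An ideal `I` of norm `N ≠ 0` has exactly `N` characters trivial on it, namely those whose conductor
divides `I`. Counting the pairs `(I, ψ)` with `I = conductor ψ * J` gives the Dirichlet convolution
`r * a = (n ↦ n a(n))`, where `a(n)` is the number of ideals of norm `n`
(`sum_numTwistIsoclasses_mul_idealCount`). The global formula is this identity for L-series.
Restricted to powers of `p`, it is a Cauchy product and gives the local formula.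

It remains to find `a(p ^ k)`. Since `𝓞 K = ℤ[θ]`, Kummer–Dedekind reads the primes over `p` from
the roots of the quadratic modulo `p`. The resulting local factors are nonzero, and the Euler
product then shows that the Dedekind zeta function does not vanish. -/

namespace HeisenbergZeta

/-! ### Matrix coordinates on the Heisenberg group -/

section Coordinates

variable {R : Type*} [CommRing R]

/-- The unitriangular matrix with entries `a`, `b` next to the diagonal and `c` in the corner. -/
def unitri (a b c : R) : heisenberg R :=
  ⟨⟨!![1, a, c; 0, 1, b; 0, 0, 1], by simp [Matrix.det_fin_three]⟩, by
    refine ⟨fun i => ?_, fun i j hij => ?_⟩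
    · fin_cases i <;> rfl
    · fin_cases i <;> fin_cases j <;> first
        | exact absurd hij (by decide)
        | rfl⟩

/-- The `(1, 2)` entry. -/
def ent12 (g : heisenberg R) : R := g.1.1 0 1

/-- The `(2, 3)` entry. -/
def ent23 (g : heisenberg R) : R := g.1.1 1 2

/-- The `(1, 3)` entry. -/
def ent13 (g : heisenberg R) : R := g.1.1 0 2

@[simp] lemma ent12_unitri (a b c : R) : ent12 (unitri a b c) = a := rfl
@[simp] lemma ent23_unitri (a b c : R) : ent23 (unitri a b c) = b := rfl
@[simp] lemma ent13_unitri (a b c : R) : ent13 (unitri a b c) = c := rfl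

@[simp] lemma ent12_one : ent12 (1 : heisenberg R) = 0 := by simp [ent12]
@[simp] lemma ent23_one : ent23 (1 : heisenberg R) = 0 := by simp [ent23]
@[simp] lemma ent13_one : ent13 (1 : heisenberg R) = 0 := by simp [ent13]

@[simp] lemma ent12_mul (g h : heisenberg R) : ent12 (g * h) = ent12 g + ent12 h := by
  have h1 := g.2.1 0
  have h2 := h.2.1 1
  have h3 := h.2.2 2 1 (by decide)
  simp [ent12, Matrix.mul_apply, Fin.sum_univ_three, h1, h2, h3, add_comm]

@[simp] lemma ent23_mul (g h : heisenberg R) : ent23 (g * h) = ent23 g + ent23 h := by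
  have h1 := g.2.1 1
  have h2 := h.2.1 2
  have h3 := g.2.2 1 0 (by decide)
  simp [ent23, Matrix.mul_apply, Fin.sum_univ_three, h1, h2, h3, add_comm]

@[simp] lemma ent13_mul (g h : heisenberg R) :
    ent13 (g * h) = ent13 g + ent13 h + ent12 g * ent23 h := by
  have h1 := g.2.1 0
  have h2 := h.2.1 2
  simp [ent13, ent12, ent23, Matrix.mul_apply, Fin.sum_univ_three, h1, h2]
  ring

lemma heisenberg_ext {g h : heisenberg R} (h12 : ent12 g = ent12 h) (h23 : ent23 g = ent23 h)
    (h13 : ent13 g = ent13 h) : g = h := by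
  apply Subtype.ext
  apply Subtype.ext
  ext i j
  rcases lt_trichotomy i j with hij | rfl | hij
  · fin_cases i <;> fin_cases j <;> first
      | exact absurd hij (by decide)
      | assumption
  · exact (g.2.1 i).trans (h.2.1 i).symm
  · exact (g.2.2 i j hij).trans (h.2.2 i j hij).symm

lemma unitri_mul (a b c a' b' c' : R) :
    unitri a b c * unitri a' b' c' = unitri (a + a') (b + b') (c + c' + a * b') := by
  apply heisenberg_ext <;> simp

lemma unitri_zero : unitri (0 : R) 0 0 = 1 := by
  apply heisenberg_ext <;> simp

/-- The corner element is the commutator of `unitri 1 0 0` and `unitri 0 c 0`, so it dies in every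
commutative group. Twists therefore leave central characters unchanged. -/
lemma map_center_eq_one {M : Type*} [CommGroup M] (χ : heisenberg R →* M) (c : R) :
    χ (unitri 0 0 c) = 1 := by
  have h : unitri 1 0 0 * unitri 0 c 0 = unitri 0 0 c * (unitri 0 c 0 * unitri 1 0 0) := by
    apply heisenberg_ext <;> simp
  have h' := congrArg χ h
  simp only [map_mul] at h'
  rw [mul_comm (χ (unitri 0 c 0))] at h'
  exact (right_eq_mul.mp h')

/-- The one-dimensional representation of the Heisenberg group attached to two characters
of `R`. -/
noncomputable def linearChar (ξ η : AddChar R ℂ) : heisenberg R →* ℂˣ :=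
  MonoidHom.toHomUnits
    { toFun := fun g => ξ (ent12 g) * η (ent23 g)
      map_one' := by simp
      map_mul' := fun g h => by
        simp only [ent12_mul, ent23_mul, AddChar.map_add_eq_mul]
        ring }

@[simp] lemma coe_linearChar (ξ η : AddChar R ℂ) (g : heisenberg R) :
    (linearChar ξ η g : ℂ) = ξ (ent12 g) * η (ent23 g) := rfl

end Coordinates

/-! ### The conductor of an additive character and its pairing -/

section Conductor

variable {R : Type*} [CommRing R]

lemma addChar_ne_zero {A : Type*} [AddCommGroup A] (ψ : AddChar A ℂ) (a : A) : ψ a ≠ 0 :=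
  (ψ.val_isUnit a).ne_zero

/-- The largest ideal on which the additive character `ψ` is trivial. -/
def conductor (ψ : AddChar R ℂ) : Ideal R where
  carrier := {a | ∀ b, ψ (a * b) = 1}
  zero_mem' := fun b => by simp
  add_mem' := fun {x y} hx hy b => by
    rw [add_mul, AddChar.map_add_eq_mul, hx b, hy b, one_mul]
  smul_mem' := fun r x hx b => by
    rw [smul_eq_mul, mul_comm r x, mul_assoc]
    exact hx _

/-- An ideal is contained in the conductor as soon as the character is trivial on it. -/
lemma le_conductor_iff {ψ : AddChar R ℂ} {I : Ideal R} :
    I ≤ conductor ψ ↔ ∀ a ∈ I, ψ a = 1 := by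
  refine ⟨fun h a ha => by simpa using h ha 1, fun h a ha b => h _ (I.mul_mem_right b ha)⟩

/-- The pairing `(a, b) ↦ ψ (a b)` on `R ⧸ conductor ψ` and `R`. -/
noncomputable def pairing (ψ : AddChar R ℂ) (t : R ⧸ conductor ψ) (b : R) : ℂ := ψ (t.out * b)

/-- The representative `out` is harmless: two representatives differ by an element of the conductor,
whose multiples `ψ` does not see. -/
lemma pairing_mk (ψ : AddChar R ℂ) (a b : R) :
    pairing ψ (Ideal.Quotient.mk (conductor ψ) a) b = ψ (a * b) := by
  have h : (Ideal.Quotient.mk (conductor ψ) a).out - a ∈ conductor ψ := by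
    rw [← Ideal.Quotient.eq]
    exact Quotient.out_eq _
  have h1 := h b
  rw [sub_mul] at h1
  rw [pairing, ← sub_add_cancel ((Ideal.Quotient.mk (conductor ψ) a).out * b) (a * b),
    AddChar.map_add_eq_mul, h1, one_mul]

lemma pairing_add (ψ : AddChar R ℂ) (s t : R ⧸ conductor ψ) (b : R) :
    pairing ψ (s + t) b = pairing ψ s b * pairing ψ t b := by
  obtain ⟨s, rfl⟩ := Ideal.Quotient.mk_surjective s
  obtain ⟨t, rfl⟩ := Ideal.Quotient.mk_surjective t
  rw [← map_add, pairing_mk, pairing_mk, pairing_mk, add_mul, AddChar.map_add_eq_mul]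

lemma pairing_add_right (ψ : AddChar R ℂ) (s : R ⧸ conductor ψ) (b c : R) :
    pairing ψ s (b + c) = pairing ψ s b * pairing ψ s c := by
  rw [pairing, mul_add, AddChar.map_add_eq_mul]; rfl

@[simp] lemma pairing_zero_right (ψ : AddChar R ℂ) (s : R ⧸ conductor ψ) : pairing ψ s 0 = 1 := by
  simp [pairing]

/-- Nondegeneracy on the left, which is what the conductor is made for. It separates the points of
the quotient by eigenvalues of the `unitri 0 b 0`. -/
lemma exists_pairing_ne {ψ : AddChar R ℂ} {s t : R ⧸ conductor ψ} (h : s ≠ t) :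
    ∃ b, pairing ψ s b ≠ pairing ψ t b := by
  by_contra! H
  apply h
  obtain ⟨s, rfl⟩ := Ideal.Quotient.mk_surjective s
  obtain ⟨t, rfl⟩ := Ideal.Quotient.mk_surjective t
  rw [Ideal.Quotient.eq]
  intro b
  have := H b
  rw [pairing_mk, pairing_mk] at this
  rw [sub_mul, AddChar.map_sub_eq_div, this, div_self (addChar_ne_zero ψ _)]

end Conductor

/-! ### Schrödinger representations -/

section Model

variable {R : Type*} [CommRing R] (ψ : AddChar R ℂ) {ι : Type*} (e : ι ≃ R ⧸ conductor ψ)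

/-- The Schrödinger representation with central character `ψ`, on functions on
`R ⧸ conductor ψ` (reindexed along `e`). -/
noncomputable def schrodinger : Representation ℂ (heisenberg R) (ι → ℂ) where
  toFun g :=
    { toFun := fun f i => ψ (ent13 g) * pairing ψ (e i) (ent23 g) *
        f (e.symm (e i + Ideal.Quotient.mk _ (ent12 g)))
      map_add' := fun f f' => by ext i; simp [mul_add]
      map_smul' := fun r f => by ext i; simp; ring }
  map_one' := by
    apply LinearMap.ext
    intro f
    ext i
    simp
  map_mul' g h := by
    apply LinearMap.ext
    intro f
    ext i
    simp only [LinearMap.coe_mk, AddHom.coe_mk, Module.End.mul_apply, Equiv.apply_symm_apply,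
      ent12_mul, ent13_mul, ent23_mul, AddChar.map_add_eq_mul, map_add, pairing_add,
      pairing_add_right, pairing_mk, add_assoc]
    ring

lemma schrodinger_apply (g : heisenberg R) (f : ι → ℂ) (i : ι) :
    schrodinger ψ e g f i = ψ (ent13 g) * pairing ψ (e i) (ent23 g) *
        f (e.symm (e i + Ideal.Quotient.mk _ (ent12 g))) := rfl

lemma schrodinger_center (c : R) : schrodinger ψ e (unitri 0 0 c) = ψ c • LinearMap.id := by
  apply LinearMap.ext
  intro f
  ext i
  simp [schrodinger_apply]

lemma schrodinger_single [DecidableEq ι] (g : heisenberg R) (i : ι) (r : ℂ) :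
    schrodinger ψ e g (Pi.single i r) =
      Pi.single (e.symm (e i - Ideal.Quotient.mk _ (ent12 g)))
        (ψ (ent13 g) * pairing ψ (e i - Ideal.Quotient.mk _ (ent12 g)) (ent23 g) * r) := by
  ext j
  rw [schrodinger_apply]
  by_cases h : j = e.symm (e i - Ideal.Quotient.mk _ (ent12 g))
  · subst h
    simp
  · rw [Pi.single_eq_of_ne h, Pi.single_eq_of_ne, mul_zero]
    intro h'
    apply h
    rw [← h']
    simp

/-- The `unitri 0 b 0` are diagonal and separate the coordinates, so a nonzero vector of an
invariant subspace can be cut down to a point mass. The translations `unitri a 0 0` carry that to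
every other point mass. -/
theorem schrodinger_irreducible [Finite ι] : (schrodinger ψ e).IsIrreducible := by
  classical
  have := Fintype.ofFinite ι
  have hne : (⊥ : Subrepresentation (schrodinger ψ e)) ≠ ⊤ := by
    intro h
    have h1 : (Pi.single (e.symm 0) 1 : ι → ℂ) ∈ (⊥ : Subrepresentation (schrodinger ψ e)) := by
      rw [h]; exact Submodule.mem_top
    have h2 : (Pi.single (e.symm 0) 1 : ι → ℂ) = 0 := h1
    simpa using congrFun h2 (e.symm 0)
  refine { exists_pair_ne := ⟨⊥, ⊤, hne⟩, eq_bot_or_eq_top := fun U => ?_ }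
  by_cases hU : ∀ f ∈ U.toSubmodule, f = 0
  · left
    apply Subrepresentation.toSubmodule_injective
    exact (Submodule.eq_bot_iff _).mpr hU
  right
  push Not at hU
  obtain ⟨f₀, hf₀, hne₀⟩ := hU
  obtain ⟨i₀, hi₀⟩ : ∃ i, f₀ i ≠ 0 := by
    by_contra! H
    exact hne₀ (funext H)
  have key : ∀ S : Finset ι, i₀ ∉ S → ∃ f ∈ U.toSubmodule, f i₀ ≠ 0 ∧ ∀ j ∈ S, f j = 0 := by
    intro S
    induction S using Finset.induction_on with
    | empty => exact fun _ => ⟨f₀, hf₀, hi₀, by simp⟩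
    | insert j S hj ih =>
      intro hi
      rw [Finset.mem_insert, not_or] at hi
      obtain ⟨f, hf, hfi, hfS⟩ := ih hi.2
      obtain ⟨b, hb⟩ := exists_pairing_ne (ψ := ψ) (e.injective.ne hi.1)
      -- Subtracting the eigenvalue at `j` kills coordinate `j` and keeps the earlier zeros; `b` was
      -- chosen so that coordinate `i₀` survives.
      refine ⟨schrodinger ψ e (unitri 0 b 0) f - pairing ψ (e j) b • f,
        sub_mem (U.apply_mem_toSubmodule _ hf) (Submodule.smul_mem _ _ hf), ?_, ?_⟩
      · simp [schrodinger_apply, ← sub_mul, hfi, sub_ne_zero.mpr hb]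
      · intro k hk
        rcases Finset.mem_insert.mp hk with rfl | hk
        · simp [schrodinger_apply]
        · simp [schrodinger_apply, hfS k hk]
  obtain ⟨f, hf, hfi, hf0⟩ := key (Finset.univ.erase i₀) (by simp)
  have hf1 : f = Pi.single i₀ (f i₀) := by
    ext j
    by_cases h : j = i₀
    · subst h; simp
    · rw [Pi.single_eq_of_ne h]; exact hf0 j (by simp [h])
  rw [hf1] at hf
  have hsingle : ∀ i, (Pi.single i 1 : ι → ℂ) ∈ U.toSubmodule := by
    intro i
    obtain ⟨a, ha⟩ := Ideal.Quotient.mk_surjective (e i₀ - e i)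
    have h1 := Submodule.smul_mem _ (f i₀)⁻¹ (U.apply_mem_toSubmodule (unitri a 0 0) hf)
    rw [schrodinger_single] at h1
    simpa [ha, ← Pi.single_smul', hfi] using h1
  apply Subrepresentation.toSubmodule_injective
  refine (Submodule.eq_top_iff'.mpr fun f => ?_ : U.toSubmodule = ⊤)
  rw [pi_eq_sum_univ' f]
  refine Submodule.sum_mem _ fun i _ => Submodule.smul_mem _ _ ?_
  convert hsingle i using 1

/-- The centre acts by the scalars `ψ c`, which neither a twist nor an isomorphism can alter. -/
lemma schrodinger_twist_injective {ψ' : AddChar R ℂ} (e' : ι ≃ R ⧸ conductor ψ')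
    (h : TwistEquivalent (schrodinger ψ e) (schrodinger ψ' e')) : ψ = ψ' := by
  classical
  obtain ⟨χ, ⟨φ⟩⟩ := h
  ext c
  have h1 := LinearMap.congr_fun (φ.toIntertwiningMap.isIntertwining' (unitri 0 0 c))
    (Pi.single (e.symm 0) 1)
  set v : ι → ℂ := Pi.single (e.symm 0) 1 with hv
  have h2 : φ.toLinearEquiv ((χ (unitri 0 0 c) : ℂ) • schrodinger ψ e (unitri 0 0 c) v) =
    schrodinger ψ' e' (unitri 0 0 c) (φ.toLinearEquiv v) := h1
  rw [map_center_eq_one, schrodinger_center, schrodinger_center] at h2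
  simp only [Units.val_one, one_smul, LinearMap.smul_apply, LinearMap.id_apply, map_smul] at h2
  refine smul_left_injective ℂ (m := φ.toLinearEquiv v) ?_ h2
  rw [ne_eq, LinearEquiv.map_eq_zero_iff]
  intro h
  simpa [hv] using congrFun h (e.symm 0)

end Model

end HeisenbergZeta

namespace HeisenbergZeta

/-! ### Common eigenvectors of commuting operators -/

section CommonEigenvector

variable {V : Type*} [AddCommGroup V] [Module ℂ V] [FiniteDimensional ℂ V] [Nontrivial V]

/-- Commuting operators on a nonzero finite-dimensional complex space have a common
eigenvector. -/
lemma exists_common_eigenvector {ι : Type*} (T : ι → Module.End ℂ V)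
    (hT : ∀ i j, Commute (T i) (T j)) : ∃ v : V, v ≠ 0 ∧ ∀ i, ∃ c : ℂ, T i v = c • v := by
  -- Take a minimal nonzero subspace stable under all `T i`. Its intersection with an eigenspace of
  -- one `T i` is stable by commutation, so by minimality each `T i` is scalar on it.
  obtain ⟨W, ⟨hW0, hW⟩, hmin⟩ := WellFounded.has_min (wellFounded_lt (α := Submodule ℂ V))
    {W | W ≠ ⊥ ∧ ∀ i, ∀ w ∈ W, T i w ∈ W} ⟨⊤, top_ne_bot, fun _ _ _ => Submodule.mem_top⟩
  obtain ⟨v, hv, hv0⟩ := W.ne_bot_iff.mp hW0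
  refine ⟨v, hv0, fun i => ?_⟩
  have : Nontrivial W := Submodule.nontrivial_iff_ne_bot.mpr hW0
  obtain ⟨c, hc⟩ := Module.End.exists_eigenvalue ((T i).restrict (hW i))
  obtain ⟨w, hw⟩ := hc.exists_hasEigenvector
  refine ⟨c, ?_⟩
  have hw1 : T i w = c • (w : V) := congrArg Subtype.val hw.apply_eq_smul
  have hw0 : (w : V) ≠ 0 := fun h => hw.2 (Subtype.ext h)
  by_contra hne
  refine hmin (W ⊓ (T i).eigenspace c) ⟨?_, ?_⟩ ?_
  · rw [Submodule.ne_bot_iff]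
    exact ⟨w, ⟨w.2, Module.End.mem_eigenspace_iff.mpr hw1⟩, hw0⟩
  · rintro j u ⟨hu, hu'⟩
    refine ⟨hW j u hu, ?_⟩
    rw [SetLike.mem_coe, Module.End.mem_eigenspace_iff] at hu' ⊢
    have := LinearMap.congr_fun (hT i j).eq u
    simp only [Module.End.mul_apply] at this
    rw [this, hu', map_smul]
  · refine lt_of_le_of_ne inf_le_left fun h => hne ?_
    rw [← h] at hv
    exact Module.End.mem_eigenspace_iff.mp hv.2

lemma exists_addChar_eigenvector {A : Type*} [AddCommGroup A]
    (T : Multiplicative A →* Module.End ℂ V) :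
    ∃ (η : AddChar A ℂ) (v : V), v ≠ 0 ∧ ∀ a, T (.ofAdd a) v = η a • v := by
  obtain ⟨v, hv, h⟩ := exists_common_eigenvector T fun i j => by
    rw [Commute, SemiconjBy, ← map_mul, mul_comm, map_mul]
  choose c hc using h
  have hinj := smul_left_injective ℂ (m := v) hv
  refine ⟨⟨fun a => c (.ofAdd a), hinj ?_, fun a b => hinj ?_⟩, v, hv, fun a => hc _⟩
  · simp only
    rw [← hc, ofAdd_zero, map_one, one_smul, Module.End.one_apply]
  · simp only
    rw [← hc, ofAdd_add, map_mul, Module.End.mul_apply, hc, map_smul, hc, smul_smul, mul_comm]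

end CommonEigenvector

/-! ### Irreducible representations up to twist -/

section Classification

variable {R : Type*} [CommRing R] {V : Type*} [AddCommGroup V] [Module ℂ V]

/-- A nonzero vector of an irreducible representation lies in no proper invariant subspace. -/
lemma eq_top_of_invariant {G : Type*} [Monoid G] {ρ : Representation ℂ G V}
    (hρ : ρ.IsIrreducible) (U : Submodule ℂ V) (hU : ∀ g, ∀ u ∈ U, ρ g u ∈ U)
    {v : V} (hv : v ≠ 0) (hvU : v ∈ U) : U = ⊤ := by
  rcases hρ.eq_bot_or_eq_top ⟨U, hU⟩ with h | h
  · exact absurd ((Submodule.eq_bot_iff U).mp (congrArg (·.toSubmodule) h) v hvU) hv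
  · exact congrArg (·.toSubmodule) h

lemma nontrivial_of_isIrreducible {G : Type*} [Monoid G] {ρ : Representation ℂ G V}
    (hρ : ρ.IsIrreducible) : Nontrivial V := by
  by_contra h
  rw [not_nontrivial_iff_subsingleton] at h
  obtain ⟨U, U', hU⟩ := hρ.exists_pair_ne
  apply hU
  apply Subrepresentation.toSubmodule_injective
  exact Subsingleton.elim _ _

/-- The embedding of `R` as the matrices `unitri a 0 0`. -/
def unitriHom₁ (R : Type*) [CommRing R] : Multiplicative R →* heisenberg R where
  toFun a := unitri a.toAdd 0 0
  map_one' := unitri_zero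
  map_mul' a b := by rw [unitri_mul]; simp

/-- The embedding of `R × R` as the matrices `unitri 0 b c`. -/
def unitriHom₂ (R : Type*) [CommRing R] : Multiplicative (R × R) →* heisenberg R where
  toFun a := unitri 0 a.toAdd.1 a.toAdd.2
  map_one' := unitri_zero
  map_mul' a b := by rw [unitri_mul]; simp

/-- After a twist, an irreducible representation has a central character `ψ`, the elements
`unitri a 0 0` with `a` in the conductor of `ψ` act trivially, and all elements `unitri 0 b 0`
fix a common nonzero vector. -/
lemma exists_twist_normalized [FiniteDimensional ℂ V] (ρ : Representation ℂ (heisenberg R) V)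
    (hρ : ρ.IsIrreducible) :
    ∃ (ψ : AddChar R ℂ) (χ : heisenberg R →* ℂˣ) (v : V), v ≠ 0 ∧
      (∀ c w, twist χ ρ (unitri 0 0 c) w = ψ c • w) ∧
      (∀ a ∈ conductor ψ, ∀ w, twist χ ρ (unitri a 0 0) w = w) ∧
      (∀ b, twist χ ρ (unitri 0 b 0) v = v) := by
  have := nontrivial_of_isIrreducible hρ
  obtain ⟨η, v, hv, hη⟩ := exists_addChar_eigenvector (ρ.comp (unitriHom₂ R))
  obtain ⟨ξ, w, hw, hξ⟩ := exists_addChar_eigenvector (ρ.comp (unitriHom₁ R))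
  replace hη : ∀ b c, ρ (unitri 0 b c) v = η (b, c) • v := fun b c => hη (b, c)
  replace hξ : ∀ a, ρ (unitri a 0 0) w = ξ a • w := hξ
  set ψ : AddChar R ℂ := η.compAddMonoidHom (AddMonoidHom.inr R R) with hψ
  set η' : AddChar R ℂ := η.compAddMonoidHom (AddMonoidHom.inl R R) with hη'
  have hcomm : ∀ {g h : heisenberg R}, g * h = h * g → ∀ u, ρ g (ρ h u) = ρ h (ρ g u) := by
    intro g h hgh u
    rw [← Module.End.mul_apply, ← map_mul, hgh, map_mul, Module.End.mul_apply]
  have hcentral : ∀ c u, ρ (unitri 0 0 c) u = ψ c • u := by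
    intro c u
    have h := eq_top_of_invariant hρ (Module.End.eigenspace (ρ (unitri 0 0 c)) (ψ c)) (fun g u hu => by
      rw [Module.End.mem_eigenspace_iff] at hu ⊢
      rw [hcomm, hu, map_smul]
      apply heisenberg_ext <;> simp [add_comm]) hv (Module.End.mem_eigenspace_iff.mpr (hη 0 c))
    exact Module.End.mem_eigenspace_iff.mp (h ▸ Submodule.mem_top (x := u))
  have hcond : ∀ a ∈ conductor ψ, ∀ u, ρ (unitri a 0 0) u = ξ a • u := by
    intro a ha u
    have h := eq_top_of_invariant hρ (Module.End.eigenspace (ρ (unitri a 0 0)) (ξ a)) (fun g u hu => by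
      rw [Module.End.mem_eigenspace_iff] at hu ⊢
      -- The commutator with `g` is a corner element with entry in the conductor, on which `ψ` is
      -- trivial. So `unitri a 0 0` commutes with the whole action and is a scalar.
      have hc : unitri a 0 0 * g = unitri 0 0 (a * ent23 g) * (g * unitri a 0 0) := by
        apply heisenberg_ext <;> simp [add_comm]
      rw [← Module.End.mul_apply, ← map_mul, hc, map_mul, Module.End.mul_apply, hcentral, ha,
        one_smul, map_mul, Module.End.mul_apply, hu, map_smul]) hw
      (Module.End.mem_eigenspace_iff.mpr (hξ a))
    exact Module.End.mem_eigenspace_iff.mp (h ▸ Submodule.mem_top (x := u))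
  have htw : ∀ (χ : heisenberg R →* ℂˣ) g u, twist χ ρ g u = (χ g : ℂ) • ρ g u := fun _ _ _ => rfl
  -- One twist removes both characters. Although `ξ` is read off the other eigenvector `w`, on the
  -- conductor it gives the scalar by which `unitri a 0 0` acts everywhere.
  refine ⟨ψ, (linearChar ξ η')⁻¹, v, hv, fun c u => ?_, fun a ha u => ?_, fun b => ?_⟩
  · rw [htw, hcentral, map_center_eq_one]; simp
  · rw [htw, hcond a ha]
    simp [smul_smul, addChar_ne_zero]
  · rw [htw, hη]
    have : η (b, 0) = η' b := rfl
    simp [smul_smul, this, addChar_ne_zero]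

/-- Every finite-dimensional irreducible representation of a Heisenberg group is twist equivalent
to a Schrödinger representation. -/
theorem exists_twistEquivalent_schrodinger [FiniteDimensional ℂ V]
    (ρ : Representation ℂ (heisenberg R) V) (hρ : ρ.IsIrreducible) :
    ∃ ψ : AddChar R ℂ, Finite (R ⧸ conductor ψ) ∧
      Nat.card (R ⧸ conductor ψ) = Module.finrank ℂ V ∧
      ∀ {ι : Type} (e : ι ≃ R ⧸ conductor ψ), TwistEquivalent ρ (schrodinger ψ e) := by
  classical
  obtain ⟨ψ, χ, v, hv, hZ, hX, hY⟩ := exists_twist_normalized ρ hρ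
  set σ := twist χ ρ with hσ
  have hmul : ∀ g h u, σ (g * h) u = σ g (σ h u) := fun g h u => by
    rw [map_mul, Module.End.mul_apply]
  -- These vectors are to become the point masses. The sign matches the model, where `unitri a 0 0`
  -- moves the point mass at `t` to `t - a`.
  set u : R ⧸ conductor ψ → V := fun t => σ (unitri (-t.out) 0 0) v with hu
  have hu_mk : ∀ a, σ (unitri (-a) 0 0) v = u (Ideal.Quotient.mk _ a) := by
    intro a
    have h : (Ideal.Quotient.mk (conductor ψ) a).out - a ∈ conductor ψ := by
      rw [← Ideal.Quotient.eq]
      exact Quotient.out_eq _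
    have h1 : unitri (-a) 0 0 = unitri ((Ideal.Quotient.mk (conductor ψ) a).out - a) 0 0 *
        unitri (-(Ideal.Quotient.mk (conductor ψ) a).out) 0 0 := by
      rw [unitri_mul]; congr 1 <;> ring
    rw [h1, hmul, hX _ h]
  have hact : ∀ g t, σ g (u t) =
      (ψ (ent13 g) * pairing ψ (t - Ideal.Quotient.mk _ (ent12 g)) (ent23 g)) •
        u (t - Ideal.Quotient.mk _ (ent12 g)) := by
    intro g t
    obtain ⟨a, rfl⟩ := Ideal.Quotient.mk_surjective t
    rw [← map_sub, pairing_mk, ← hu_mk, ← hu_mk, ← hmul]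
    have h1 : g * unitri (-a) 0 0 = unitri 0 0 (ent13 g + (a - ent12 g) * ent23 g) *
        (unitri (-(a - ent12 g)) 0 0 * unitri 0 (ent23 g) 0) := by
      apply heisenberg_ext <;> simp <;> ring
    rw [h1, hmul, hZ, hmul, hY, AddChar.map_add_eq_mul]
  have hu0 : ∀ t, u t ≠ 0 := by
    intro t h
    apply hv
    have h1 : unitri t.out 0 0 * unitri (-t.out) 0 0 = (1 : heisenberg R) := by
      rw [unitri_mul]; simp [unitri_zero]
    have h2 := hmul (unitri t.out 0 0) (unitri (-t.out) 0 0) v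
    rw [h1, map_one, Module.End.one_apply] at h2
    rw [h2]
    exact (congrArg _ h).trans (map_zero _)
  have hYu : ∀ b t, σ (unitri 0 b 0) (u t) = pairing ψ t b • u t := by
    intro b t
    rw [hact]; simp
  -- The `u t` are joint eigenvectors of the `unitri 0 b 0` with distinct eigenvalue systems, so
  -- relations shrink as in the independence of characters.
  have hlin : LinearIndependent ℂ u := by
    rw [linearIndependent_iff']
    intro S
    induction S using Finset.induction_on with
    | empty => simp
    | insert j S hj ih =>
      intro c hc
      have hS : ∀ i ∈ S, c i = 0 := by
        intro i hi
        obtain ⟨b, hb⟩ := exists_pairing_ne (ψ := ψ) (s := i) (t := j)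
          (fun h => hj (h ▸ hi))
        have h1 := congrArg (σ (unitri 0 b 0)) hc
        rw [map_sum, map_zero] at h1
        have h2 := congrArg (pairing ψ j b • ·) hc
        simp only [Finset.smul_sum, smul_zero] at h2
        have h3 := h1.trans h2.symm
        rw [← sub_eq_zero, ← Finset.sum_sub_distrib, Finset.sum_insert hj] at h3
        simp only [map_smul, hYu, smul_smul, mul_comm (c _), sub_self, zero_add, ← sub_smul,
          ← sub_mul] at h3
        exact (mul_eq_zero.mp (ih _ h3 i hi)).resolve_left (sub_ne_zero.mpr hb)
      rw [Finset.sum_insert hj, Finset.sum_eq_zero (fun i hi => by rw [hS i hi, zero_smul]),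
        add_zero] at hc
      intro i hi
      rcases Finset.mem_insert.mp hi with rfl | hi
      · exact (smul_eq_zero.mp hc).resolve_right (hu0 i)
      · exact hS i hi
  -- Finiteness of the quotient is a consequence of `V` being finite-dimensional.
  have hfin : Finite (R ⧸ conductor ψ) := hlin.finite
  have hspan : Submodule.span ℂ (Set.range u) = ⊤ := by
    refine eq_top_of_invariant hρ _ (fun g w hw => ?_) (hu0 0)
      (Submodule.subset_span ⟨0, rfl⟩)
    have hσw : σ g w ∈ Submodule.span ℂ (Set.range u) := by
      induction hw using Submodule.span_induction with
      | mem x hx =>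
        obtain ⟨t, rfl⟩ := hx
        rw [hact]
        exact Submodule.smul_mem _ _ (Submodule.subset_span ⟨_, rfl⟩)
      | zero => simp
      | add x y _ _ hx hy => rw [map_add]; exact add_mem hx hy
      | smul a x _ hx => rw [map_smul]; exact Submodule.smul_mem _ _ hx
    have hρσ : ρ g w = ((χ g : ℂ))⁻¹ • σ g w := by
      rw [hσ]
      change _ = (χ g : ℂ)⁻¹ • ((χ g : ℂ) • ρ g w)
      rw [smul_smul, inv_mul_cancel₀ (χ g).ne_zero, one_smul]
    rw [hρσ]
    exact Submodule.smul_mem _ _ hσw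
  set B : Module.Basis (R ⧸ conductor ψ) ℂ V := Module.Basis.mk hlin hspan.ge with hB
  refine ⟨ψ, hfin, (Module.finrank_eq_nat_card_basis B).symm, fun {ι} e => ?_⟩
  have : Finite ι := Finite.of_equiv _ e.symm
  have := Fintype.ofFinite ι
  refine ⟨χ, ⟨.mk (B.reindex e.symm).equivFun fun g => ?_⟩⟩
  refine (B.reindex e.symm).ext fun i => ?_
  have hBi : ∀ i, (B.reindex e.symm) i = u (e i) := fun i => by simp [hB]
  have hEq : ∀ t, (B.reindex e.symm).equivFun (u t) = Pi.single (e.symm t) 1 := by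
    intro t
    rw [show u t = (B.reindex e.symm) (e.symm t) by rw [hBi, Equiv.apply_symm_apply]]
    ext j
    rw [Module.Basis.equivFun_self, Pi.single_apply]
    simp [eq_comm]
  change (B.reindex e.symm).equivFun (σ g ((B.reindex e.symm) i)) =
    schrodinger ψ e g ((B.reindex e.symm).equivFun ((B.reindex e.symm) i))
  rw [hBi, hact, map_smul, hEq, hEq, Equiv.symm_apply_apply, schrodinger_single, ← Pi.single_smul,
    smul_eq_mul]

end Classification

/-! ### Twist isoclasses as additive characters -/

section Count

variable (R : Type*) [CommRing R]

/-- The additive characters of `R` whose conductor has index `n`. -/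
abbrev CharOfIndex (n : ℕ) : Type _ :=
  {ψ : AddChar R ℂ // Finite (R ⧸ conductor ψ) ∧ Nat.card (R ⧸ conductor ψ) = n}

/-- Twist isoclasses of dimension `n` correspond to additive characters with conductor of
index `n`. -/
theorem nonempty_twistIsoclass_equiv (n : ℕ) :
    Nonempty (TwistIsoclass (heisenberg R) n ≃ CharOfIndex R n) := by
  have he : ∀ ψ : CharOfIndex R n, Nonempty (Fin n ≃ R ⧸ conductor ψ.1) := by
    rintro ⟨ψ, hf, rfl⟩
    exact ⟨(Finite.equivFin _).symm⟩
  let e := fun ψ => (he ψ).some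
  let F : CharOfIndex R n → TwistIsoclass (heisenberg R) n := fun ψ =>
    Quotient.mk _ ⟨schrodinger ψ.1 (e ψ), schrodinger_irreducible _ _⟩
  refine ⟨(Equiv.ofBijective F ⟨fun ψ ψ' h => ?_, fun q => ?_⟩).symm⟩
  · exact Subtype.ext (schrodinger_twist_injective _ _ _ (Quotient.exact h))
  · induction q using Quotient.inductionOn with
    | h ρ =>
    obtain ⟨ψ, hf, hc, h⟩ := exists_twistEquivalent_schrodinger ρ.1 ρ.2
    rw [Module.finrank_fin_fun] at hc
    refine ⟨⟨ψ, hf, hc⟩, (Quotient.sound ?_).symm⟩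
    exact h _

end Count

end HeisenbergZeta

namespace HeisenbergZeta

open NumberField

/-! ### Counting characters by the norm of the conductor -/

section Count

/-- Additive characters trivial on `I` are the additive characters of `R ⧸ I`. -/
noncomputable def charQuotientEquiv {R : Type*} [CommRing R] (I : Ideal R) :
    {ψ : AddChar R ℂ // I ≤ conductor ψ} ≃ AddChar (R ⧸ I) ℂ where
  toFun ψ := AddChar.toAddMonoidHomEquiv.symm
    (QuotientAddGroup.lift I.toAddSubgroup ψ.1.toAddMonoidHom
      (fun a ha => le_conductor_iff.mp ψ.2 a ha))
  invFun φ := ⟨φ.compAddMonoidHom (Ideal.Quotient.mk I).toAddMonoidHom,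
    le_conductor_iff.mpr fun a ha => by
      simp [Ideal.Quotient.eq_zero_iff_mem.mpr ha]⟩
  left_inv ψ := by
    apply Subtype.ext
    ext a
    rfl
  right_inv φ := by
    ext t
    obtain ⟨a, rfl⟩ := Ideal.Quotient.mk_surjective t
    rfl

variable (K : Type*) [Field K] [NumberField K]

/-- The number of ideals of norm `n`. -/
noncomputable def idealCount (n : ℕ) : ℕ := Nat.card {I : Ideal (𝓞 K) // Ideal.absNorm I = n}

instance finite_ideal_absNorm (n : ℕ) : Finite {I : Ideal (𝓞 K) // Ideal.absNorm I = n} :=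
  Ideal.finite_setOfPred_absNorm_eq n

variable {K} in
lemma natCard_quotient (I : Ideal (𝓞 K)) : Nat.card (𝓞 K ⧸ I) = Ideal.absNorm I := rfl

variable {K} in
lemma finite_char_le {I : Ideal (𝓞 K)} (hI : Ideal.absNorm I ≠ 0) :
    Finite {ψ : AddChar (𝓞 K) ℂ // I ≤ conductor ψ} := by
  have := (Ideal.absNorm_ne_zero_iff I).mp hI
  have : Finite (AddChar (𝓞 K ⧸ I) ℂ) := inferInstance
  exact Finite.of_equiv _ (charQuotientEquiv I).symm

variable {K} in
-- These characters form the dual of the finite group `𝓞 K ⧸ I`, which has the same order as the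
-- group.
lemma natCard_char_le {I : Ideal (𝓞 K)} (hI : Ideal.absNorm I ≠ 0) :
    Nat.card {ψ : AddChar (𝓞 K) ℂ // I ≤ conductor ψ} = Ideal.absNorm I := by
  have := (Ideal.absNorm_ne_zero_iff I).mp hI
  have := Fintype.ofFinite (𝓞 K ⧸ I)
  rw [Nat.card_congr (charQuotientEquiv I), Nat.card_eq_fintype_card, AddChar.card_eq,
    ← Nat.card_eq_fintype_card, natCard_quotient]

lemma finite_char_absNorm {n : ℕ} (hn : n ≠ 0) :
    Finite {ψ : AddChar (𝓞 K) ℂ // Ideal.absNorm (conductor ψ) = n} := by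
  have : ∀ I : {I : Ideal (𝓞 K) // Ideal.absNorm I = n},
      Finite {ψ : AddChar (𝓞 K) ℂ // I.1 ≤ conductor ψ} := fun I =>
    finite_char_le (by rw [I.2]; exact hn)
  refine Finite.of_injective
    (β := Σ I : {I : Ideal (𝓞 K) // Ideal.absNorm I = n},
      {ψ : AddChar (𝓞 K) ℂ // I.1 ≤ conductor ψ})
    (fun ψ => ⟨⟨conductor ψ.1, ψ.2⟩, ⟨ψ.1, le_rfl⟩⟩) fun ψ ψ' h => ?_
  have := congrArg (fun x => x.2.1) h
  exact Subtype.ext this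

variable {K} in
-- `n ≠ 0` matters: `absNorm` takes the value `0` when the quotient is infinite.
lemma charOfIndex_iff {n : ℕ} (hn : n ≠ 0) (ψ : AddChar (𝓞 K) ℂ) :
    (Finite (𝓞 K ⧸ conductor ψ) ∧ Nat.card (𝓞 K ⧸ conductor ψ) = n) ↔
      Ideal.absNorm (conductor ψ) = n := by
  refine ⟨fun h => h.2, fun h => ⟨?_, h⟩⟩
  rw [← Ideal.absNorm_ne_zero_iff, h]
  exact hn

lemma finite_twistIsoclass (n : ℕ) : Finite (TwistIsoclass (heisenberg (𝓞 K)) n) := by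
  obtain ⟨e⟩ := nonempty_twistIsoclass_equiv (𝓞 K) n
  refine @Finite.of_equiv _ _ ?_ e.symm
  rcases eq_or_ne n 0 with rfl | hn
  · have : IsEmpty (CharOfIndex (𝓞 K) 0) := by
      refine ⟨fun ⟨ψ, hf, h⟩ => ?_⟩
      exact Nat.card_pos.ne' h
    infer_instance
  · have := finite_char_absNorm K hn
    exact Finite.of_equiv _ (Equiv.subtypeEquivRight fun ψ => (charOfIndex_iff hn ψ).symm)

lemma numTwistIsoclasses_eq {n : ℕ} (hn : n ≠ 0) :
    numTwistIsoclasses (heisenberg (𝓞 K)) n =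
      Nat.card {ψ : AddChar (𝓞 K) ℂ // Ideal.absNorm (conductor ψ) = n} := by
  obtain ⟨e⟩ := nonempty_twistIsoclass_equiv (𝓞 K) n
  rw [numTwistIsoclasses, Nat.card_congr e]
  exact Nat.card_congr (Equiv.subtypeEquivRight fun ψ => charOfIndex_iff hn ψ)

/-- Counting pairs of an ideal of norm `N` and a character trivial on it in two ways. -/
theorem sum_numTwistIsoclasses_mul_idealCount {N : ℕ} (hN : N ≠ 0) :
    ∑ x ∈ N.divisorsAntidiagonal,
      numTwistIsoclasses (heisenberg (𝓞 K)) x.1 * idealCount K x.2 = N * idealCount K N := by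
  have hne : ∀ x : N.divisorsAntidiagonal, x.1.1 ≠ 0 := fun x =>
    (Nat.ne_zero_of_mem_divisorsAntidiagonal x.2).1
  have h1 : Nat.card (Σ I : {I : Ideal (𝓞 K) // Ideal.absNorm I = N},
      {ψ : AddChar (𝓞 K) ℂ // I.1 ≤ conductor ψ}) = N * idealCount K N := by
    have := Fintype.ofFinite {I : Ideal (𝓞 K) // Ideal.absNorm I = N}
    have : ∀ I : {I : Ideal (𝓞 K) // Ideal.absNorm I = N},
        Finite {ψ : AddChar (𝓞 K) ℂ // I.1 ≤ conductor ψ} := fun I =>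
      finite_char_le (by rw [I.2]; exact hN)
    rw [Nat.card_sigma, Finset.sum_congr rfl fun I _ =>
      (natCard_char_le (by rw [I.2]; exact hN)).trans I.2]
    simp [idealCount, mul_comm]
  have h2 : Nat.card (Σ x : N.divisorsAntidiagonal,
      {ψ : AddChar (𝓞 K) ℂ // Ideal.absNorm (conductor ψ) = x.1.1} ×
        {J : Ideal (𝓞 K) // Ideal.absNorm J = x.1.2}) =
      ∑ x ∈ N.divisorsAntidiagonal,
        numTwistIsoclasses (heisenberg (𝓞 K)) x.1 * idealCount K x.2 := by
    have := fun x => finite_char_absNorm K (hne x)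
    rw [Nat.card_sigma, ← Finset.sum_coe_sort N.divisorsAntidiagonal]
    refine Finset.sum_congr rfl fun x _ => ?_
    rw [Nat.card_prod, numTwistIsoclasses_eq K (hne x), idealCount]
  rw [← h1, ← h2]
  -- To contain is to divide: `I ≤ conductor ψ` means `I = conductor ψ * J`, with `J` unique since
  -- the conductor has nonzero norm.
  let F : (Σ x : N.divisorsAntidiagonal,
      {ψ : AddChar (𝓞 K) ℂ // Ideal.absNorm (conductor ψ) = x.1.1} ×
        {J : Ideal (𝓞 K) // Ideal.absNorm J = x.1.2}) →
      (Σ I : {I : Ideal (𝓞 K) // Ideal.absNorm I = N},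
        {ψ : AddChar (𝓞 K) ℂ // I.1 ≤ conductor ψ}) := fun y =>
    ⟨⟨conductor y.2.1.1 * y.2.2.1, by
      rw [map_mul, y.2.1.2, y.2.2.2]
      exact (Nat.mem_divisorsAntidiagonal.mp y.1.2).1⟩, ⟨y.2.1.1, Ideal.mul_le_left⟩⟩
  refine Nat.card_congr (Equiv.ofBijective F ⟨?_, ?_⟩)
  · rintro ⟨⟨⟨m, k⟩, hx⟩, ⟨ψ, hψ⟩, ⟨J, hJ⟩⟩ ⟨⟨⟨m', k'⟩, hx'⟩, ⟨ψ', hψ'⟩, ⟨J', hJ'⟩⟩ h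
    have e1 : ψ = ψ' := congrArg (fun y => y.2.1) h
    have e2 : conductor ψ * J = conductor ψ' * J' := congrArg (fun y => y.1.1) h
    subst e1
    have hm : m ≠ 0 := (Nat.ne_zero_of_mem_divisorsAntidiagonal hx).1
    have hc : conductor ψ ≠ 0 := by
      intro h0
      simp only at hψ
      rw [h0, map_zero] at hψ
      exact hm hψ.symm
    have e3 := mul_left_cancel₀ hc e2
    subst e3
    simp only at hψ hJ hψ' hJ'
    subst hψ hJ hψ' hJ'
    rfl
  · rintro ⟨⟨I, hI⟩, ⟨ψ, hψ⟩⟩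
    obtain ⟨J, rfl⟩ := Ideal.dvd_iff_le.mpr hψ
    refine ⟨⟨⟨(Ideal.absNorm (conductor ψ), Ideal.absNorm J), ?_⟩, ⟨ψ, rfl⟩, ⟨J, rfl⟩⟩, rfl⟩
    rw [Nat.mem_divisorsAntidiagonal, ← map_mul]
    exact ⟨hI, hN⟩

end Count

/-! ### Multiplicativity of the ideal count -/

section Multiplicativity

variable {K : Type*} [Field K] [NumberField K]

lemma idealCount_one : idealCount K 1 = 1 := by
  rw [idealCount, Nat.card_eq_one_iff_unique]
  refine ⟨⟨fun I J => Subtype.ext ?_⟩, ⟨⟨⊤, Ideal.absNorm_top⟩⟩⟩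
  rw [Ideal.absNorm_eq_one_iff.mp I.2, Ideal.absNorm_eq_one_iff.mp J.2]

lemma idealCount_zero : idealCount K 0 = 1 := by
  rw [idealCount, Nat.card_eq_one_iff_unique]
  refine ⟨⟨fun I J => Subtype.ext ?_⟩, ⟨⟨⊥, Ideal.absNorm_bot⟩⟩⟩
  rw [Ideal.absNorm_eq_zero_iff.mp I.2, Ideal.absNorm_eq_zero_iff.mp J.2]

/-- An ideal factor of norm `m` can be recovered from the product when the complementary factor
has coprime norm. -/
lemma mul_sup_span_eq {m n : ℕ} (h : m.Coprime n) {J L : Ideal (𝓞 K)}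
    (hJ : Ideal.absNorm J = m) (hL : Ideal.absNorm L = n) :
    J * L ⊔ Ideal.span {(m : 𝓞 K)} = J := by
  have hmJ : (m : 𝓞 K) ∈ J := hJ ▸ Ideal.absNorm_mem J
  have hnL : (n : 𝓞 K) ∈ L := hL ▸ Ideal.absNorm_mem L
  refine le_antisymm (sup_le Ideal.mul_le_left ((Ideal.span_singleton_le_iff_mem J).mpr hmJ))
    fun x hx => ?_
  obtain ⟨u, v, huv⟩ := Nat.isCoprime_iff_coprime.mpr h
  have huv' : (u : 𝓞 K) * m + v * n = 1 := by exact_mod_cast congrArg (Int.cast (R := 𝓞 K)) huv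
  have hx' : x = x * (v * n) + (x * u) * m := by
    rw [mul_assoc, ← mul_add, add_comm, huv', mul_one]
  rw [hx']
  refine Submodule.add_mem_sup (Ideal.mul_mem_mul hx (L.mul_mem_left _ hnL)) ?_
  exact Ideal.mul_mem_left _ _ (Ideal.mem_span_singleton_self _)

/-- An ideal `I` of norm `m n` factors uniquely as `(I + (m)) (I + (n))`. -/
lemma idealCount_mul {m n : ℕ} (h : m.Coprime n) :
    idealCount K (m * n) = idealCount K m * idealCount K n := by
  rw [idealCount, idealCount, idealCount, ← Nat.card_prod]
  symm
  let F : {I : Ideal (𝓞 K) // Ideal.absNorm I = m} × {I : Ideal (𝓞 K) // Ideal.absNorm I = n} →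
      {I : Ideal (𝓞 K) // Ideal.absNorm I = m * n} := fun x =>
    ⟨x.1.1 * x.2.1, by rw [map_mul, x.1.2, x.2.2]⟩
  refine Nat.card_congr (Equiv.ofBijective F ⟨?_, ?_⟩)
  · rintro ⟨⟨J, hJ⟩, ⟨L, hL⟩⟩ ⟨⟨J', hJ'⟩, ⟨L', hL'⟩⟩ hF
    have e : J * L = J' * L' := congrArg Subtype.val hF
    have e1 : J = J' := by
      rw [← mul_sup_span_eq h hJ hL, ← mul_sup_span_eq h hJ' hL', e]
    have e2 : L = L' := by
      rw [← mul_sup_span_eq h.symm hL hJ, ← mul_sup_span_eq h.symm hL' hJ', mul_comm, e, mul_comm]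
    subst e1 e2
    rfl
  · rintro ⟨I, hI⟩
    set J := I ⊔ Ideal.span {(m : 𝓞 K)} with hJ
    set L := I ⊔ Ideal.span {(n : 𝓞 K)} with hL
    obtain ⟨u, v, huv⟩ := Nat.isCoprime_iff_coprime.mpr h
    have huv' : (u : 𝓞 K) * m + v * n = 1 := by exact_mod_cast congrArg (Int.cast (R := 𝓞 K)) huv
    have hmJ : (m : 𝓞 K) ∈ J := Ideal.mem_sup_right (Ideal.mem_span_singleton_self _)
    have hnL : (n : 𝓞 K) ∈ L := Ideal.mem_sup_right (Ideal.mem_span_singleton_self _)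
    have hcop : J ⊔ L = ⊤ := by
      rw [Ideal.eq_top_iff_one, ← huv']
      exact Submodule.add_mem_sup (J.mul_mem_left _ hmJ) (L.mul_mem_left _ hnL)
    have hJL : J * L = I := by
      refine le_antisymm ?_ ?_
      · rw [hJ, hL, Ideal.sup_mul, Ideal.mul_sup, Ideal.mul_sup]
        refine sup_le (sup_le Ideal.mul_le_right Ideal.mul_le_left) (sup_le Ideal.mul_le_right ?_)
        rw [Ideal.span_singleton_mul_span_singleton, Ideal.span_singleton_le_iff_mem,
          ← Nat.cast_mul, ← hI]
        exact Ideal.absNorm_mem I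
      · rw [Ideal.mul_eq_inf_of_coprime hcop]
        exact le_inf le_sup_left le_sup_left
    -- The norm of `J` divides a power of `m`, so it is prime to `n`; likewise for `L` and `m`.
    -- Since the norms multiply to `m n`, they must be `m` and `n`.
    have hdvd : ∀ {k : ℕ} {M : Ideal (𝓞 K)}, (k : 𝓞 K) ∈ M →
        Ideal.absNorm M ∣ k ^ Module.finrank ℤ (𝓞 K) := fun {k M} hM => by
      rw [← Ideal.absNorm_span_natCast]
      exact Ideal.absNorm_dvd_absNorm_of_le ((Ideal.span_singleton_le_iff_mem M).mpr hM)
    have hN : Ideal.absNorm J * Ideal.absNorm L = m * n := by rw [← map_mul, hJL, hI]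
    have c1 : (Ideal.absNorm J).Coprime n := (h.pow_left _).coprime_dvd_left (hdvd hmJ)
    have c2 : (Ideal.absNorm L).Coprime m := (h.symm.pow_left _).coprime_dvd_left (hdvd hnL)
    have d1 : Ideal.absNorm J ∣ m := c1.dvd_of_dvd_mul_right (hN ▸ Dvd.intro _ rfl)
    have d2 : m ∣ Ideal.absNorm J := c2.symm.dvd_of_dvd_mul_right (hN ▸ Dvd.intro _ rfl)
    have d3 : Ideal.absNorm L ∣ n := c2.dvd_of_dvd_mul_left (hN ▸ Dvd.intro_left _ rfl)
    have d4 : n ∣ Ideal.absNorm L := c1.symm.dvd_of_dvd_mul_left (hN ▸ Dvd.intro_left _ rfl)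
    exact ⟨⟨⟨J, Nat.dvd_antisymm d1 d2⟩, ⟨L, Nat.dvd_antisymm d3 d4⟩⟩, Subtype.ext hJL⟩

end Multiplicativity

end HeisenbergZeta

namespace HeisenbergZeta

open NumberField

/-! ### Ideals of prime power norm -/

section PrimePowers

variable {K : Type*} [Field K] [NumberField K] {p : ℕ}

/-- A nontrivial ideal of `p`-power norm has a prime factor over `p`. -/
lemma exists_primesOver_mul (hp : p.Prime) {k : ℕ} (hk : k ≠ 0) {I : Ideal (𝓞 K)}
    (hI : Ideal.absNorm I = p ^ k) :
    ∃ P ∈ Ideal.primesOver (Ideal.span {(p : ℤ)}) (𝓞 K), ∃ J, I = P * J := by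
  obtain ⟨P, hP, hPp, J, rfl⟩ :=
    Ideal.exists_isMaximal_dvd_of_dvd_absNorm' hp I (hI ▸ dvd_pow_self p hk)
  exact ⟨P, ⟨hP.isPrime, ⟨hPp.symm⟩⟩, J, rfl⟩

/-- The ideals of `p`-power norm satisfy an induction principle over prime factors. -/
lemma primePow_induction (hp : p.Prime) {C : Ideal (𝓞 K) → Prop} (h1 : C 1)
    (hmul : ∀ P ∈ Ideal.primesOver (Ideal.span {(p : ℤ)}) (𝓞 K), ∀ J, C J → C (P * J))
    (hnorm : ∀ P ∈ Ideal.primesOver (Ideal.span {(p : ℤ)}) (𝓞 K), Ideal.absNorm P ≠ 1)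
    {k : ℕ} {I : Ideal (𝓞 K)} (hI : Ideal.absNorm I = p ^ k) : C I := by
  induction k using Nat.strong_induction_on generalizing I with
  | _ k ih =>
    rcases eq_or_ne k 0 with rfl | hk
    · rw [pow_zero, Ideal.absNorm_eq_one_iff] at hI
      rw [hI, ← Ideal.one_eq_top]
      exact h1
    · obtain ⟨P, hP, J, rfl⟩ := exists_primesOver_mul hp hk hI
      rw [map_mul] at hI
      obtain ⟨m, hm, hJ⟩ := (Nat.dvd_prime_pow hp).mp (hI ▸ Dvd.intro_left _ rfl)
      refine hmul P hP J (ih m (lt_of_le_of_ne hm fun h => hnorm P hP ?_) hJ)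
      rw [hJ, h] at hI
      exact Nat.eq_of_mul_eq_mul_right (pow_pos hp.pos k) (by rw [hI, one_mul])

/-- Only powers `P ^ j` occur, and these have norm `p ^ (f * j)`. -/
lemma idealCount_prime_pow_of_unique (hp : p.Prime) {P : Ideal (𝓞 K)} {f : ℕ} (hf : f ≠ 0)
    (hP : Ideal.primesOver (Ideal.span {(p : ℤ)}) (𝓞 K) = {P})
    (hN : Ideal.absNorm P = p ^ f) (k : ℕ) :
    idealCount K (p ^ k) = if f ∣ k then 1 else 0 := by
  have hpow : ∀ {k : ℕ} {I : Ideal (𝓞 K)}, Ideal.absNorm I = p ^ k → ∃ j, I = P ^ j := by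
    intro k I hI
    refine primePow_induction (C := fun I => ∃ j, I = P ^ j) hp ⟨0, (pow_zero P).symm⟩ ?_ ?_ hI
    · rw [hP]
      rintro _ rfl J ⟨j, rfl⟩
      exact ⟨j + 1, (pow_succ' _ _).symm⟩
    · rw [hP]
      rintro _ rfl h
      rw [hN] at h
      exact (Nat.one_lt_pow hf hp.one_lt).ne' h
  split_ifs with hk
  · obtain ⟨j, rfl⟩ := hk
    rw [idealCount, Nat.card_eq_one_iff_unique]
    refine ⟨⟨?_⟩, ⟨⟨P ^ j, by rw [map_pow, hN, pow_mul]⟩⟩⟩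
    rintro ⟨I, hI⟩ ⟨J, hJ⟩
    apply Subtype.ext
    obtain ⟨a, rfl⟩ := hpow hI
    obtain ⟨b, rfl⟩ := hpow hJ
    have := hI.trans hJ.symm
    rw [map_pow, map_pow, hN, ← pow_mul, ← pow_mul] at this
    exact congrArg (P ^ ·) (Nat.eq_of_mul_eq_mul_left (Nat.pos_of_ne_zero hf) (Nat.pow_right_injective hp.two_le this))
  · rw [idealCount, Nat.card_eq_zero]
    left
    refine ⟨fun ⟨I, hI⟩ => hk ?_⟩
    obtain ⟨j, rfl⟩ := hpow hI
    rw [map_pow, hN, ← pow_mul] at hI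
    exact ⟨j, (Nat.pow_right_injective hp.two_le hI).symm⟩

lemma idealCount_prime_pow_of_pair (hp : p.Prime) {P Q : Ideal (𝓞 K)} (hPQ : P ≠ Q)
    (hprimes : Ideal.primesOver (Ideal.span {(p : ℤ)}) (𝓞 K) = {P, Q})
    (hP : Ideal.absNorm P = p) (hQ : Ideal.absNorm Q = p) (k : ℕ) :
    idealCount K (p ^ k) = k + 1 := by
  have hpow : ∀ {k : ℕ} {I : Ideal (𝓞 K)}, Ideal.absNorm I = p ^ k →
      ∃ i j, I = P ^ i * Q ^ j := by
    intro k I hI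
    refine primePow_induction (C := fun I => ∃ i j, I = P ^ i * Q ^ j) hp ⟨0, 0, by simp⟩ ?_ ?_ hI
    · rw [hprimes]
      rintro _ (rfl | rfl) J ⟨i, j, rfl⟩
      · exact ⟨i + 1, j, by ring⟩
      · exact ⟨i, j + 1, by ring⟩
    · rw [hprimes]
      rintro _ (rfl | rfl) h
      · exact hp.one_lt.ne' (hP.symm.trans h)
      · exact hp.one_lt.ne' (hQ.symm.trans h)
  have hP0 : P ≠ 0 := by
    rintro rfl
    rw [map_zero] at hP
    exact hp.pos.ne hP
  have hQ0 : Q ≠ 0 := by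
    rintro rfl
    rw [map_zero] at hQ
    exact hp.pos.ne hQ
  have hPp : Prime P := Ideal.prime_of_isPrime hP0
    (show P ∈ Ideal.primesOver (Ideal.span {(p : ℤ)}) (𝓞 K) by rw [hprimes]; simp).1
  have hQp : Prime Q := Ideal.prime_of_isPrime hQ0
    (show Q ∈ Ideal.primesOver (Ideal.span {(p : ℤ)}) (𝓞 K) by rw [hprimes]; simp).1
  -- The exponent of `P` is determined, since otherwise `P` would divide a power of `Q`. The norm
  -- then fixes the exponent of `Q`.
  have hlt : ∀ i j i' j' : ℕ, i < i' → P ^ i * Q ^ j ≠ P ^ i' * Q ^ j' := by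
    intro i j i' j' hi h
    obtain ⟨c, rfl⟩ := Nat.exists_eq_add_of_lt hi
    rw [add_assoc, pow_add, mul_assoc] at h
    have h1 := mul_left_cancel₀ (pow_ne_zero i hP0) h
    have h2 : P ∣ Q ^ j := h1 ▸ ((dvd_pow_self P (Nat.succ_ne_zero c)).mul_right _)
    exact hPQ (associated_iff_eq.mp (hPp.associated_of_dvd hQp (hPp.dvd_of_dvd_pow h2)))
  have hnorm : ∀ i j : ℕ, Ideal.absNorm (P ^ i * Q ^ j) = p ^ (i + j) := fun i j => by
    rw [map_mul, map_pow, map_pow, hP, hQ, pow_add]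
  let F : {x // x ∈ Finset.HasAntidiagonal.antidiagonal k} →
      {I : Ideal (𝓞 K) // Ideal.absNorm I = p ^ k} := fun x =>
    ⟨P ^ x.1.1 * Q ^ x.1.2, by rw [hnorm, Finset.HasAntidiagonal.mem_antidiagonal.mp x.2]⟩
  have hF : Function.Bijective F := by
    refine ⟨?_, ?_⟩
    · rintro ⟨⟨i, j⟩, h⟩ ⟨⟨i', j'⟩, h'⟩ e
      have e' : P ^ i * Q ^ j = P ^ i' * Q ^ j' := congrArg Subtype.val e
      simp only [Finset.HasAntidiagonal.mem_antidiagonal] at h h'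
      have hi : i = i' := by
        rcases lt_trichotomy i i' with hi | hi | hi
        · exact absurd e' (hlt _ _ _ _ hi)
        · exact hi
        · exact absurd e'.symm (hlt _ _ _ _ hi)
      subst hi
      have : j = j' := by omega
      subst this
      rfl
    · rintro ⟨I, hI⟩
      obtain ⟨i, j, rfl⟩ := hpow hI
      rw [hnorm] at hI
      exact ⟨⟨(i, j), Finset.HasAntidiagonal.mem_antidiagonal.mpr
        (Nat.pow_right_injective hp.two_le hI)⟩, rfl⟩
  rw [idealCount, ← Nat.card_congr (Equiv.ofBijective F hF), Nat.card_eq_fintype_card,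
    Fintype.card_coe, Finset.Nat.card_antidiagonal]

end PrimePowers

end HeisenbergZeta

namespace HeisenbergZeta

open NumberField Polynomial

/-! ### The ring of integers of a quadratic field -/

section QuadraticField

variable {d : ℤ} {K : Type*} [Field K] [NumberField K] {δ : K}

lemma not_isSquare_rat (hd : Squarefree d) (hd1 : d ≠ 1) (r : ℚ) : r ^ 2 ≠ (d : ℚ) := by
  intro h
  have h1 : IsSquare (d : ℚ) := ⟨r, by rw [← h, sq]⟩
  obtain ⟨m, rfl⟩ := Rat.isSquare_intCast_iff.mp h1
  have h2 := hd m (dvd_refl _)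
  rcases Int.isUnit_iff.mp h2 with rfl | rfl <;> simp at hd1

/-- A rational number `w` with `d w²` integral is integral if `d` is squarefree. -/
lemma exists_int_of_mul_sq (hd : Squarefree d) {w : ℚ} {c : ℤ} (h : (d : ℚ) * w ^ 2 = c) :
    ∃ W : ℤ, w = W := by
  have hd0 : (d : ℚ) ≠ 0 := by exact_mod_cast hd.ne_zero
  -- `d c = (d w)²` is an integer that is a rational square, hence an integer square `m²`.
  -- Squarefreeness turns `d ∣ m²` into `d ∣ m`.
  have h1 : IsSquare ((d * c : ℤ) : ℚ) := ⟨d * w, by push_cast; rw [← h]; ring⟩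
  obtain ⟨m, hm⟩ := Rat.isSquare_intCast_iff.mp h1
  have h2 : d ∣ m := by
    have : d ∣ m ^ 2 := ⟨c, by rw [sq, hm]⟩
    exact (hd.dvd_pow_iff_dvd two_ne_zero).mp this
  obtain ⟨n, rfl⟩ := h2
  have h3 : w ^ 2 = (n : ℚ) ^ 2 := by
    have h4 : (d : ℚ) * c = d * n * (d * n) := by exact_mod_cast hm
    rw [← h] at h4
    apply mul_left_cancel₀ (mul_ne_zero hd0 hd0)
    linear_combination h4
  rcases sq_eq_sq_iff_eq_or_eq_neg.mp h3 with h | h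
  · exact ⟨n, h⟩
  · exact ⟨-n, by rw [h]; push_cast; rfl⟩

lemma exists_rat_coords (hδ : δ ^ 2 = (d : K)) (hK : IntermediateField.adjoin ℚ {δ} = ⊤) (x : K) :
    ∃ u v : ℚ, x = u + v * δ := by
  have hint : IsIntegral ℚ δ :=
    ⟨X ^ 2 - C (d : ℚ), monic_X_pow_sub_C _ two_ne_zero, by
      simp only [eval₂_sub, eval₂_X_pow, eval₂_C]; simp [hδ]⟩
  have h1 : x ∈ Algebra.adjoin ℚ {δ} := by
    rw [← IntermediateField.adjoin_simple_toSubalgebra_of_isAlgebraic hint.isAlgebraic, hK]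
    exact Algebra.mem_top
  induction h1 using Algebra.adjoin_induction with
  | mem x hx => exact ⟨0, 1, by rw [Set.mem_singleton_iff.mp hx]; simp⟩
  | algebraMap r => exact ⟨r, 0, by simp⟩
  | add x y _ _ hx hy =>
    obtain ⟨u, v, rfl⟩ := hx
    obtain ⟨u', v', rfl⟩ := hy
    exact ⟨u + u', v + v', by push_cast; ring⟩
  | mul x y _ _ hx hy =>
    obtain ⟨u, v, rfl⟩ := hx
    obtain ⟨u', v', rfl⟩ := hy
    exact ⟨u * u' + v * v' * d, u * v' + v * u', by
      push_cast; linear_combination (v : K) * v' * hδ⟩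

/-- Trace and norm of an integral element are integers. -/
lemma exists_int_trace_norm (hd : Squarefree d) (hd1 : d ≠ 1) (hδ : δ ^ 2 = (d : K)) {u v : ℚ}
    (hx : IsIntegral ℤ ((u : K) + v * δ)) :
    ∃ A B : ℤ, 2 * u = A ∧ u ^ 2 - d * v ^ 2 = B := by
  rcases eq_or_ne v 0 with rfl | hv
  · have h1 : IsIntegral ℤ (algebraMap ℚ K u) := by simpa using hx
    rw [isIntegral_algebraMap_iff (algebraMap ℚ K).injective] at h1
    obtain ⟨n, rfl⟩ := IsIntegrallyClosed.isIntegral_iff.mp h1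
    exact ⟨2 * n, n ^ 2, by simp, by simp⟩
  -- For `v ≠ 0` this quadratic has no rational root, as `d` is not a rational square. It is then
  -- the minimal polynomial over `ℚ`, which for an integral element has integer coefficients.
  · set q : ℚ[X] := C 1 * X ^ 2 + C (-(2 * u)) * X + C (u ^ 2 - d * v ^ 2) with hq
    have hdeg : q.natDegree = 2 := natDegree_quadratic one_ne_zero
    have hmon : q.Monic := by
      exact leadingCoeff_quadratic one_ne_zero
    have heval : aeval ((u : K) + v * δ) q = 0 := by
      simp only [hq, map_add, map_mul, aeval_C, map_pow, aeval_X, map_neg, map_sub,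
        eq_ratCast, map_one]
      push_cast
      linear_combination (v : K) ^ 2 * hδ
    have hirr : Irreducible q := by
      rw [Polynomial.irreducible_iff_roots_eq_zero_of_degree_le_three (by rw [hdeg])
        (by rw [hdeg]; norm_num), Multiset.eq_zero_iff_forall_notMem]
      intro r hr
      have h0 := (mem_roots hmon.ne_zero).mp hr
      simp only [hq, IsRoot.def, eval_add, eval_mul, eval_C, eval_pow, eval_X] at h0
      apply not_isSquare_rat hd hd1 ((r - u) / v)
      field_simp
      linear_combination h0
    have hmin := minpoly.eq_of_irreducible_of_monic hirr heval hmon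
    rw [minpoly.isIntegrallyClosed_eq_field_fractions' ℚ hx] at hmin
    refine ⟨-(minpoly ℤ ((u : K) + v * δ)).coeff 1, (minpoly ℤ ((u : K) + v * δ)).coeff 0, ?_, ?_⟩
    · have := congrArg (coeff · 1) hmin
      simp only [hq, coeff_map, coeff_add, coeff_C_mul, coeff_X_pow, coeff_X, coeff_C] at this
      simp at this
      push_cast
      linarith
    · have := congrArg (coeff · 0) hmin
      simp only [hq, coeff_map, coeff_add, coeff_C_mul, coeff_X_pow, coeff_X, coeff_C] at this
      simpa using this

/-- The ring of integers of a quadratic field is generated by a root of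
`x² - x - (d - 1) / 4` or `x² - d`. -/
lemma exists_generator (hd : Squarefree d) (hd1 : d ≠ 1) (hδ : δ ^ 2 = (d : K))
    (hK : IntermediateField.adjoin ℚ {δ} = ⊤) :
    ∃ (θ : 𝓞 K) (t m : ℤ), θ ^ 2 = t * θ + m ∧ Algebra.adjoin ℤ {θ} = ⊤ ∧
      θ ∉ (algebraMap ℤ (𝓞 K)).range ∧
      ∀ p : ℕ, numSolutions d p = Nat.card {x : ZMod p // x ^ 2 - t * x - m = 0} := by
  -- Here `A` is the trace and `B` the norm of `x`. Congruences modulo 4 in `A² - d W² = 4 B` will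
  -- decide the parities of `A` and `W`.
  have hcoords : ∀ x : 𝓞 K, ∃ A W B : ℤ, (2 : K) * x = A + W * δ ∧ A ^ 2 - d * W ^ 2 = 4 * B := by
    intro x
    obtain ⟨u, v, hx⟩ := exists_rat_coords hδ hK (x : K)
    have hint : IsIntegral ℤ ((u : K) + v * δ) := hx ▸ RingOfIntegers.isIntegral_coe x
    obtain ⟨A, B, hA, hB⟩ := exists_int_trace_norm hd hd1 hδ hint
    have h1 : (d : ℚ) * (2 * v) ^ 2 = ((A ^ 2 - 4 * B : ℤ) : ℚ) := by
      push_cast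
      rw [← hA, ← hB]
      ring
    obtain ⟨W, hW⟩ := exists_int_of_mul_sq hd h1
    refine ⟨A, W, B, ?_, ?_⟩
    · rw [hx, mul_add, ← mul_assoc]
      congr 1
      · exact_mod_cast congrArg (Rat.cast (K := K)) hA
      · congr 1
        exact_mod_cast congrArg (Rat.cast (K := K)) hW
    · rw [hW] at h1
      have h2 : d * W ^ 2 = A ^ 2 - 4 * B := by exact_mod_cast h1
      rw [h2]
      ring
  have hδint : ∀ n : ℤ, δ ≠ n := by
    intro n h
    rw [h] at hδ
    apply not_isSquare_rat hd hd1 n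
    exact_mod_cast hδ
  have hadj : ∀ θ : 𝓞 K, (∀ x : 𝓞 K, ∃ a b : ℤ, x = a + b * θ) → Algebra.adjoin ℤ {θ} = ⊤ := by
    intro θ h
    rw [Algebra.eq_top_iff]
    intro x
    obtain ⟨a, b, rfl⟩ := h x
    exact add_mem (intCast_mem _ a) (mul_mem (intCast_mem _ b) (Algebra.self_mem_adjoin_singleton ℤ θ))
  have h4 : ¬ d % 4 = 0 := by
    intro h
    have : (2 : ℤ) * 2 ∣ d := Int.dvd_of_emod_eq_zero h
    have := hd 2 this
    rw [Int.isUnit_iff] at this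
    omega
  by_cases h1 : d % 4 = 1
  · obtain ⟨m, hm⟩ : ∃ m, d = 4 * m + 1 := ⟨d / 4, by omega⟩
    have hmK : (d : K) = 4 * m + 1 := by exact_mod_cast congrArg (Int.cast (R := K)) hm
    have hθ2 : ((1 + δ) / 2) ^ 2 = (1 + δ) / 2 + m := by
      field_simp
      linear_combination hδ + hmK
    have hint : IsIntegral ℤ ((1 + δ) / 2) := by
      refine ⟨X ^ 2 - (X + C m), monic_X_pow_sub ?_, ?_⟩
      · exact (degree_X_add_C m).trans_lt (by norm_num)
      · simp only [eval₂_sub, eval₂_add, eval₂_X, eval₂_X_pow, eval₂_C]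
        simp [hθ2]
    obtain ⟨θ, hθK⟩ : ∃ θ : 𝓞 K, algebraMap (𝓞 K) K θ = (1 + δ) / 2 := ⟨⟨_, hint⟩, rfl⟩
    refine ⟨θ, 1, m, ?_, hadj θ fun x => ?_, ?_, fun p => ?_⟩
    · apply RingOfIntegers.coe_injective
      simp only [map_add, map_mul, map_pow, map_intCast]
      rw [hθK, hθ2]
      ring
    · obtain ⟨A, W, B, hx, hAW⟩ := hcoords x
      -- For `d ≡ 1` modulo 4 the equation forces `A` and `W` to have equal parity.
      obtain ⟨T, hT⟩ : ∃ T, A = 2 * T + W := by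
        refine ⟨(A - W) / 2, ?_⟩
        rcases Int.even_or_odd' A with ⟨a, rfl | rfl⟩ <;>
          rcases Int.even_or_odd' W with ⟨w, rfl | rfl⟩ <;> subst hm <;> ring_nf at hAW <;> omega
      refine ⟨T, W, RingOfIntegers.coe_injective ?_⟩
      simp only [map_add, map_mul, map_intCast]
      rw [hθK]
      apply mul_left_cancel₀ (two_ne_zero (α := K))
      rw [hx, hT]
      push_cast
      ring
    · rintro ⟨n, hn⟩
      apply hδint (2 * n - 1)
      have := congrArg (algebraMap (𝓞 K) K) hn
      simp only [hθK] at this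
      push_cast
      simp at this
      rw [this]
      ring
    · have hm' : (d - 1) / 4 = m := by omega
      rw [numSolutions, if_pos h1, hm']
      simp
  · have hint : IsIntegral ℤ δ := ⟨X ^ 2 - C d, monic_X_pow_sub_C _ two_ne_zero, by
      simp only [eval₂_sub, eval₂_X_pow, eval₂_C]; simp [hδ]⟩
    obtain ⟨θ, hθK⟩ : ∃ θ : 𝓞 K, algebraMap (𝓞 K) K θ = δ := ⟨⟨_, hint⟩, rfl⟩
    refine ⟨θ, 0, d, ?_, hadj θ fun x => ?_, ?_, fun p => ?_⟩
    · apply RingOfIntegers.coe_injective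
      simp only [map_add, map_mul, map_pow, map_intCast]
      rw [hθK, hδ]
      ring
    · obtain ⟨A, W, B, hx, hAW⟩ := hcoords x
      -- For `d ≡ 2, 3` modulo 4 the equation forces both to be even.
      obtain ⟨⟨T, hT⟩, ⟨w, hw⟩⟩ : (∃ T, A = 2 * T) ∧ ∃ w, W = 2 * w := by
        obtain ⟨q, r, hd'⟩ : ∃ q r, d = 4 * q + r ∧ (r = 2 ∨ r = 3) := ⟨d / 4, d % 4, by omega⟩
        rcases Int.even_or_odd' A with ⟨a, rfl | rfl⟩ <;>
          rcases Int.even_or_odd' W with ⟨w, rfl | rfl⟩ <;>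
            rcases hd' with ⟨rfl, rfl | rfl⟩ <;> ring_nf at hAW <;> first
            | exact ⟨⟨a, rfl⟩, ⟨w, rfl⟩⟩
            | omega
      refine ⟨T, w, RingOfIntegers.coe_injective ?_⟩
      simp only [map_add, map_mul, map_intCast]
      rw [hθK]
      apply mul_left_cancel₀ (two_ne_zero (α := K))
      rw [hx, hT, hw]
      push_cast
      ring
    · rintro ⟨n, hn⟩
      apply hδint n
      have := congrArg (algebraMap (𝓞 K) K) hn
      simp only [hθK] at this
      simp at this
      exact this.symm
    · rw [numSolutions, if_neg h1]
      simp

end QuadraticField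

end HeisenbergZeta

namespace HeisenbergZeta

open NumberField Polynomial UniqueFactorizationMonoid

/-! ### Decomposition of primes by Kummer–Dedekind -/

section Splitting

variable {K : Type*} [Field K] [NumberField K]

lemma minpoly_eq_quadratic {θ : 𝓞 K} {t m : ℤ} (hθ : θ ^ 2 = t * θ + m)
    (hθ' : θ ∉ (algebraMap ℤ (𝓞 K)).range) :
    minpoly ℤ θ = C 1 * X ^ 2 + C (-t) * X + C (-m) := by
  have hint : IsIntegral ℤ θ := Algebra.IsIntegral.isIntegral θ
  have hdeg : (C 1 * X ^ 2 + C (-t) * X + C (-m) : ℤ[X]).natDegree = 2 :=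
    natDegree_quadratic one_ne_zero
  refine eq_of_monic_of_dvd_of_natDegree_le (minpoly.monic hint)
    (leadingCoeff_quadratic one_ne_zero) ?_ ?_ |>.symm
  · refine minpoly.isIntegrallyClosed_dvd hint ?_
    simp only [aeval_add, aeval_mul, map_pow, aeval_X, map_neg, map_one, eq_intCast,
      map_intCast]
    linear_combination hθ
  · rw [hdeg]
    exact (minpoly.two_le_natDegree_iff hint).mpr hθ'

/-- The reduction of `x² - t x - m` modulo `p`. -/
noncomputable abbrev quadraticMod (t m : ℤ) (p : ℕ) : (ZMod p)[X] :=
  C 1 * X ^ 2 + C (-(t : ZMod p)) * X + C (-(m : ZMod p))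

lemma quadraticMod_eq_mul {p : ℕ} {t m : ℤ} {a : ZMod p} (ha : a ^ 2 - t * a - m = 0) :
    quadraticMod t m p = (X - C a) * (X - C (t - a)) := by
  have : (m : ZMod p) = a ^ 2 - t * a := by linear_combination -ha
  rw [quadraticMod, this]
  simp only [map_one, map_neg, map_sub, map_mul, map_pow]
  ring

variable {θ : 𝓞 K} {t m : ℤ} {p : ℕ}

/-- The decomposition of a rational prime in a quadratic order `ℤ[θ] = 𝓞 K`, read off from the
monic irreducible factors of the minimal polynomial. -/
lemma exists_primesOver_equiv_factors (hθ : θ ^ 2 = t * θ + m)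
    (hθ' : θ ∉ (algebraMap ℤ (𝓞 K)).range) (hadj : Algebra.adjoin ℤ {θ} = ⊤) (hp : p.Prime) :
    ∃ E : Ideal.primesOver (Ideal.span {(p : ℤ)}) (𝓞 K) ≃
        {Q : (ZMod p)[X] // Irreducible Q ∧ Q.Monic ∧ Q ∣ quadraticMod t m p},
      ∀ P, Ideal.absNorm P.1 = p ^ (E P).1.natDegree := by
  have : Fact p.Prime := ⟨hp⟩
  -- As `ℤ[θ]` is all of `𝓞 K`, the exponent is 1 and no prime is excluded.
  have hexp : ¬ p ∣ RingOfIntegers.exponent θ := by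
    rw [RingOfIntegers.exponent_eq_one_iff.mpr hadj, Nat.dvd_one]
    exact hp.one_lt.ne'
  have hmap : (minpoly ℤ θ).map (Int.castRingHom (ZMod p)) = quadraticMod t m p := by
    rw [minpoly_eq_quadratic hθ hθ']
    simp only [Polynomial.map_add, Polynomial.map_mul, Polynomial.map_pow, map_C, map_X]
    simp [quadraticMod]
  have hne : (minpoly ℤ θ).map (Int.castRingHom (ZMod p)) ≠ 0 :=
    map_monic_ne_zero (minpoly.monic θ.isIntegral)
  refine ⟨(Ideal.primesOverSpanEquivMonicFactorsMod hexp).trans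
    (Equiv.subtypeEquivRight fun Q => by
      rw [Multiset.mem_toFinset, Polynomial.mem_normalizedFactors_iff hne, hmap]), fun P => ?_⟩
  obtain ⟨⟨Q, hQ⟩, rfl⟩ := (Ideal.primesOverSpanEquivMonicFactorsMod hexp).symm.surjective P
  have h := Ideal.inertiaDeg_primesOverSpanEquivMonicFactorsMod_symm_apply' hexp hQ
  set P := (Ideal.primesOverSpanEquivMonicFactorsMod hexp).symm ⟨Q, hQ⟩ with hP
  have hlies : P.1.LiesOver (Ideal.span {(p : ℤ)}) := P.2.2
  have hprime : P.1.IsPrime := P.2.1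
  have hpmax : (Ideal.span {(p : ℤ)}).IsMaximal := Int.ideal_span_isMaximal_of_prime p
  have hmax : P.1.IsMaximal := Ideal.IsMaximal.of_liesOver_isMaximal P.1 (Ideal.span {(p : ℤ)})
  rw [Ideal.absNorm_eq_pow_inertiaDeg' P.1 hp,
    Ideal.inertiaDeg'_eq_inertiaDeg (Ideal.span {(p : ℤ)}) P.1, h]
  simp [hP]

lemma factors_of_no_root [Fact p.Prime] (h : IsEmpty {x : ZMod p // x ^ 2 - t * x - m = 0})
    (Q : (ZMod p)[X]) :
    (Irreducible Q ∧ Q.Monic ∧ Q ∣ quadraticMod t m p) ↔ Q = quadraticMod t m p := by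
  have hdeg : (quadraticMod t m p).natDegree = 2 := natDegree_quadratic one_ne_zero
  have hmon : (quadraticMod t m p).Monic := leadingCoeff_quadratic one_ne_zero
  have hirr : Irreducible (quadraticMod t m p) := by
    rw [Polynomial.irreducible_iff_roots_eq_zero_of_degree_le_three (by rw [hdeg])
      (by rw [hdeg]; norm_num), Multiset.eq_zero_iff_forall_notMem]
    intro r hr
    have h0 := (mem_roots hmon.ne_zero).mp hr
    simp only [quadraticMod, IsRoot.def, eval_add, eval_mul, eval_C, eval_pow, eval_X] at h0
    exact h.false ⟨r, by linear_combination h0⟩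
  constructor
  · rintro ⟨h1, h2, h3⟩
    exact eq_of_monic_of_associated h2 hmon (h1.associated_of_dvd hirr h3)
  · rintro rfl
    exact ⟨hirr, hmon, dvd_rfl⟩

lemma factors_of_root [Fact p.Prime] {a : ZMod p} (ha : a ^ 2 - t * a - m = 0)
    (Q : (ZMod p)[X]) :
    (Irreducible Q ∧ Q.Monic ∧ Q ∣ quadraticMod t m p) ↔ Q = X - C a ∨ Q = X - C (t - a) := by
  rw [quadraticMod_eq_mul ha]
  constructor
  · rintro ⟨h1, h2, h3⟩
    rcases h1.prime.dvd_or_dvd h3 with h | h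
    · exact .inl (eq_of_monic_of_associated h2 (monic_X_sub_C _)
        (h1.associated_of_dvd (irreducible_X_sub_C _) h))
    · exact .inr (eq_of_monic_of_associated h2 (monic_X_sub_C _)
        (h1.associated_of_dvd (irreducible_X_sub_C _) h))
  · rintro (rfl | rfl)
    · exact ⟨irreducible_X_sub_C _, monic_X_sub_C _, dvd_mul_right _ _⟩
    · exact ⟨irreducible_X_sub_C _, monic_X_sub_C _, dvd_mul_left _ _⟩

lemma root_iff [Fact p.Prime] {a : ZMod p} (ha : a ^ 2 - t * a - m = 0) (x : ZMod p) :
    x ^ 2 - t * x - m = 0 ↔ x = a ∨ x = t - a := by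
  have h : x ^ 2 - t * x - m = (x - a) * (x - (t - a)) := by linear_combination ha
  rw [h, mul_eq_zero, sub_eq_zero, sub_eq_zero]

lemma natCard_roots [Fact p.Prime] {a : ZMod p} (ha : a ^ 2 - t * a - m = 0) :
    Nat.card {x : ZMod p // x ^ 2 - t * x - m = 0} = if a = t - a then 1 else 2 := by
  have h : {x : ZMod p | x ^ 2 - t * x - m = 0} = {a, t - a} := by
    ext x
    exact root_iff ha x
  change Nat.card ({x : ZMod p | x ^ 2 - t * x - m = 0} : Set (ZMod p)) = _
  rw [h, Nat.card_coe_set_eq]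
  split_ifs with h'
  · rw [← h', Set.pair_eq_singleton, Set.ncard_singleton]
  · exact Set.ncard_pair h'

/-- The number of ideals of norm `p ^ k` in a quadratic field, according to the number of roots
modulo `p` of the polynomial defining the ring of integers. -/
theorem idealCount_of_natCard_roots (hθ : θ ^ 2 = t * θ + m)
    (hθ' : θ ∉ (algebraMap ℤ (𝓞 K)).range) (hadj : Algebra.adjoin ℤ {θ} = ⊤) (hp : p.Prime) :
    (Nat.card {x : ZMod p // x ^ 2 - t * x - m = 0} = 0 ∧
      ∀ k, idealCount K (p ^ k) = if 2 ∣ k then 1 else 0) ∨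
    (Nat.card {x : ZMod p // x ^ 2 - t * x - m = 0} = 2 ∧ ∀ k, idealCount K (p ^ k) = k + 1) ∨
    (Nat.card {x : ZMod p // x ^ 2 - t * x - m = 0} = 1 ∧ ∀ k, idealCount K (p ^ k) = 1) := by
  have : Fact p.Prime := ⟨hp⟩
  obtain ⟨E, hE⟩ := exists_primesOver_equiv_factors hθ hθ' hadj hp
  rcases isEmpty_or_nonempty {x : ZMod p // x ^ 2 - t * x - m = 0} with h | ⟨⟨a, ha⟩⟩
  · left
    refine ⟨Finite.card_eq_zero_iff.mpr h, ?_⟩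
    set P := E.symm ⟨_, (factors_of_no_root h _).mpr rfl⟩ with hP
    refine idealCount_prime_pow_of_unique hp two_ne_zero (P := P.1) ?_ ?_
    · refine Set.eq_singleton_iff_unique_mem.mpr ⟨P.2, fun Q hQ => ?_⟩
      refine congrArg Subtype.val (?_ : (⟨Q, hQ⟩ : Ideal.primesOver _ _) = P)
      rw [hP, Equiv.eq_symm_apply]
      exact Subtype.ext ((factors_of_no_root h _).mp (E ⟨Q, hQ⟩).2)
    · rw [hE, hP, Equiv.apply_symm_apply]
      rw [natDegree_quadratic one_ne_zero]
  right
  have hP := (factors_of_root ha (X - C a)).mpr (.inl rfl)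
  have hP' := (factors_of_root ha (X - C (t - a))).mpr (.inr rfl)
  have hcases : ∀ Q : Ideal.primesOver (Ideal.span {(p : ℤ)}) (𝓞 K),
      Q = E.symm ⟨_, hP⟩ ∨ Q = E.symm ⟨_, hP'⟩ := fun Q => by
    rw [Equiv.eq_symm_apply, Equiv.eq_symm_apply]
    exact ((factors_of_root ha _).mp (E Q).2).imp Subtype.ext Subtype.ext
  have hN : Ideal.absNorm (E.symm ⟨_, hP⟩).1 = p := by simp [hE]
  have hN' : Ideal.absNorm (E.symm ⟨_, hP'⟩).1 = p := by
    rw [hE, Equiv.apply_symm_apply, natDegree_X_sub_C, pow_one]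
  -- The roots are `a` and `t - a`. A double root gives a single prime of norm `p`, distinct roots
  -- give two.
  by_cases h : a = t - a
  · right
    refine ⟨by rw [natCard_roots ha, if_pos h], fun k => ?_⟩
    rw [idealCount_prime_pow_of_unique hp one_ne_zero (P := (E.symm ⟨_, hP⟩).1) ?_ (by simp [hN]),
      if_pos (one_dvd k)]
    refine Set.eq_singleton_iff_unique_mem.mpr ⟨(E.symm ⟨_, hP⟩).2, fun Q hQ => ?_⟩
    rcases hcases ⟨Q, hQ⟩ with h' | h'
    · exact congrArg Subtype.val h'
    · have := congrArg Subtype.val h'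
      simp only [← h] at this
      exact this
  · left
    refine ⟨by rw [natCard_roots ha, if_neg h], idealCount_prime_pow_of_pair hp
      (P := (E.symm ⟨_, hP⟩).1) (Q := (E.symm ⟨_, hP'⟩).1) ?_ ?_ hN hN'⟩
    · intro h'
      have h1 := E.symm.injective (Subtype.ext h')
      have h2 : (X - C a : (ZMod p)[X]) = X - C (t - a) := congrArg Subtype.val h1
      exact h (C_injective (sub_right_injective h2))
    · ext Q
      constructor
      · intro hQ
        exact (hcases ⟨Q, hQ⟩).imp (congrArg Subtype.val) (congrArg Subtype.val)
      · rintro (rfl | rfl)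
        · exact (E.symm ⟨_, hP⟩).2
        · exact (E.symm ⟨_, hP'⟩).2

end Splitting

end HeisenbergZeta

namespace HeisenbergZeta

open NumberField

/-! ### Generating functions and Cauchy products -/

section Local

/-- The generating function `1 / (1 - y ^ 2)`. -/
lemma hasSum_even_pow {y : ℂ} (hy : ‖y‖ < 1) :
    HasSum (fun k : ℕ => (if 2 ∣ k then 1 else 0 : ℂ) * y ^ k) (1 - y ^ 2)⁻¹ := by
  have hy2 : ‖y ^ 2‖ < 1 := by
    rw [norm_pow]
    exact pow_lt_one₀ (norm_nonneg _) hy two_ne_zero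
  have hinj : Function.Injective fun k : ℕ => 2 * k := fun a b h => by simpa using h
  rw [← hinj.hasSum_iff]
  · have e : ((fun k : ℕ => (if 2 ∣ k then 1 else 0 : ℂ) * y ^ k) ∘ fun k => 2 * k) =
        fun k => (y ^ 2) ^ k := by
      funext k
      simp [pow_mul]
    rw [e]
    exact hasSum_geometric_of_norm_lt_one hy2
  · intro k hk
    rw [if_neg, zero_mul]
    rintro ⟨j, rfl⟩
    exact hk ⟨j, rfl⟩

/-- The generating function `1 / (1 - y) ^ 2`. -/
lemma hasSum_succ_mul_pow {y : ℂ} (hy : ‖y‖ < 1) :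
    HasSum (fun k : ℕ => ((k : ℂ) + 1) * y ^ k) ((1 - y)⁻¹ ^ 2) := by
  have hy1 : 1 - y ≠ 0 := by
    rw [sub_ne_zero]
    rintro rfl
    simp at hy
  have h := (hasSum_coe_mul_geometric_of_norm_lt_one hy).add (hasSum_geometric_of_norm_lt_one hy)
  have e : y / (1 - y) ^ 2 + (1 - y)⁻¹ = (1 - y)⁻¹ ^ 2 := by
    field_simp
    ring
  rw [e] at h
  simpa only [add_mul, one_mul] using h

/-- Cauchy products with growth `a k ≤ k + 1`. -/
lemma local_factor_mul {p : ℕ} {a r : ℕ → ℕ} (h0 : a 0 = 1) (ha : ∀ k, a k ≤ k + 1)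
    (hr : ∀ k, ∑ x ∈ Finset.HasAntidiagonal.antidiagonal k, r x.1 * a x.2 = p ^ k * a k) {y : ℂ}
    (hy : ‖y‖ < 1) (hpy : ‖p * y‖ < 1) :
    Summable (fun k => (r k : ℂ) * y ^ k) ∧
      (∑' k, (r k : ℂ) * y ^ k) * ∑' k, (a k : ℂ) * y ^ k = ∑' k, (a k : ℂ) * (p * y) ^ k := by
  have hsum : ∀ {z : ℂ}, ‖z‖ < 1 → Summable fun k => ‖(a k : ℂ) * z ^ k‖ := by
    intro z hz
    refine Summable.of_nonneg_of_le (fun k => norm_nonneg _) (fun k => ?_)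
      (hasSum_succ_mul_pow hz).summable.norm
    rw [norm_mul, norm_mul]
    refine mul_le_mul_of_nonneg_right ?_ (norm_nonneg _)
    have : ‖((k : ℂ) + 1)‖ = (k : ℝ) + 1 := by
      rw [← Nat.cast_succ, Complex.norm_natCast, Nat.cast_succ]
    rw [this, Complex.norm_natCast]
    exact_mod_cast ha k
  -- The term `(k, 0)` alone gives this bound because `a 0 = 1`. It transfers absolute convergence
  -- at `p y` for `a` to convergence at `y` for `r`.
  have hle : ∀ k, r k ≤ p ^ k * a k := fun k => by
    rw [← hr k]
    have := Finset.single_le_sum (f := fun x : ℕ × ℕ => r x.1 * a x.2) (fun _ _ => Nat.zero_le _)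
      (show (k, 0) ∈ Finset.HasAntidiagonal.antidiagonal k by simp)
    simpa [h0] using this
  have hrs : Summable fun k => ‖(r k : ℂ) * y ^ k‖ := by
    refine Summable.of_nonneg_of_le (fun k => norm_nonneg _) (fun k => ?_) (hsum hpy)
    have e : (a k : ℂ) * (p * y) ^ k = ((p ^ k * a k : ℕ) : ℂ) * y ^ k := by
      push_cast
      ring
    rw [e, norm_mul, norm_mul, Complex.norm_natCast, Complex.norm_natCast]
    exact mul_le_mul_of_nonneg_right (by exact_mod_cast hle k) (norm_nonneg _)
  refine ⟨hrs.of_norm, ?_⟩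
  rw [tsum_mul_tsum_eq_tsum_sum_antidiagonal_of_summable_norm hrs (hsum hy)]
  refine tsum_congr fun k => ?_
  rw [mul_pow, ← mul_assoc, mul_comm (a k : ℂ)]
  have := congrArg (Nat.cast (R := ℂ)) (hr k)
  push_cast at this
  rw [← this, Finset.sum_mul]
  refine Finset.sum_congr rfl fun x hx => ?_
  rw [← Finset.HasAntidiagonal.mem_antidiagonal.mp hx, pow_add]
  ring

lemma norm_natCast_cpow_neg_lt_one {p : ℕ} (hp : p.Prime) {s : ℂ} (hs : 0 < s.re) :
    ‖(p : ℂ) ^ (-s)‖ < 1 := by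
  rw [Complex.norm_natCast_cpow_of_pos hp.pos, Complex.neg_re]
  exact Real.rpow_lt_one_of_one_lt_of_neg (by exact_mod_cast hp.one_lt) (by linarith)

lemma natCast_mul_cpow_neg {p : ℕ} (hp : p.Prime) (s : ℂ) :
    (p : ℂ) * (p : ℂ) ^ (-s) = (p : ℂ) ^ (1 - s) := by
  rw [sub_eq_add_neg, Complex.cpow_add _ _ (by exact_mod_cast hp.ne_zero), Complex.cpow_one]

end Local

/-! ### Local zeta functions -/

section LocalZeta

variable {d : ℤ} {K : Type*} [Field K] [NumberField K] {δ : K}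

/-- The number of ideals of prime power norm in a quadratic field. -/
theorem idealCount_prime_pow (hd : Squarefree d) (hd1 : d ≠ 1) (hδ : δ ^ 2 = (d : K))
    (hK : IntermediateField.adjoin ℚ {δ} = ⊤) {p : ℕ} (hp : p.Prime) :
    (IsInert d p ∧ ∀ k, idealCount K (p ^ k) = if 2 ∣ k then 1 else 0) ∨
    (Splits d p ∧ ∀ k, idealCount K (p ^ k) = k + 1) ∨
    (IsRamified d p ∧ ∀ k, idealCount K (p ^ k) = 1) := by
  obtain ⟨θ, t, m, hθ, hadj, hθ', hnum⟩ := exists_generator hd hd1 hδ hK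
  rw [IsInert, Splits, IsRamified, hnum p]
  exact idealCount_of_natCard_roots hθ hθ' hadj hp

variable (K) in
-- All divisors of `p ^ k` are powers of `p`, so the convolution identity restricts to them, without
-- an Euler product for `r`.
lemma sum_antidiagonal_numTwistIsoclasses {p : ℕ} (hp : p.Prime) (k : ℕ) :
    ∑ x ∈ Finset.HasAntidiagonal.antidiagonal k,
      numTwistIsoclasses (heisenberg (𝓞 K)) (p ^ x.1) * idealCount K (p ^ x.2) =
        p ^ k * idealCount K (p ^ k) := by
  rw [← sum_numTwistIsoclasses_mul_idealCount K (pow_ne_zero k hp.ne_zero),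
    Nat.sum_divisorsAntidiagonal (f := fun a b =>
      numTwistIsoclasses (heisenberg (𝓞 K)) a * idealCount K b), Nat.sum_divisors_prime_pow hp,
    Finset.Nat.sum_antidiagonal_eq_sum_range_succ (fun a b =>
      numTwistIsoclasses (heisenberg (𝓞 K)) (p ^ a) * idealCount K (p ^ b))]
  refine Finset.sum_congr rfl fun i hi => ?_
  rw [Nat.pow_div (Finset.mem_range_succ_iff.mp hi) hp.pos]

/-- The local factor of the Dedekind zeta function of a quadratic field. -/
lemma tsum_idealCount_prime_pow (hd : Squarefree d) (hd1 : d ≠ 1) (hδ : δ ^ 2 = (d : K))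
    (hK : IntermediateField.adjoin ℚ {δ} = ⊤) {p : ℕ} (hp : p.Prime) {y : ℂ} (hy : ‖y‖ < 1) :
    (IsInert d p → ∑' k, (idealCount K (p ^ k) : ℂ) * y ^ k = (1 - y ^ 2)⁻¹) ∧
    (Splits d p → ∑' k, (idealCount K (p ^ k) : ℂ) * y ^ k = (1 - y)⁻¹ ^ 2) ∧
    (IsRamified d p → ∑' k, (idealCount K (p ^ k) : ℂ) * y ^ k = (1 - y)⁻¹) := by
  simp only [IsInert, Splits, IsRamified]
  rcases idealCount_prime_pow hd hd1 hδ hK hp with ⟨h, hk⟩ | ⟨h, hk⟩ | ⟨h, hk⟩ <;>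
    simp only [IsInert, Splits, IsRamified] at h <;>
    refine ⟨fun h' => ?_, fun h' => ?_, fun h' => ?_⟩ <;> first
    | omega
    | simp only [hk]
  · exact_mod_cast (hasSum_even_pow hy).tsum_eq
  · exact_mod_cast (hasSum_succ_mul_pow hy).tsum_eq
  · simpa using tsum_geometric_of_norm_lt_one hy

lemma idealCount_prime_pow_le (hd : Squarefree d) (hd1 : d ≠ 1) (hδ : δ ^ 2 = (d : K))
    (hK : IntermediateField.adjoin ℚ {δ} = ⊤) {p : ℕ} (hp : p.Prime) (k : ℕ) :
    idealCount K (p ^ k) ≤ k + 1 := by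
  rcases idealCount_prime_pow hd hd1 hδ hK hp with ⟨_, hk⟩ | ⟨_, hk⟩ | ⟨_, hk⟩ <;> rw [hk]
  · split_ifs <;> omega
  · omega

lemma tsum_idealCount_prime_pow_ne_zero (hd : Squarefree d) (hd1 : d ≠ 1) (hδ : δ ^ 2 = (d : K))
    (hK : IntermediateField.adjoin ℚ {δ} = ⊤) {p : ℕ} (hp : p.Prime) {y : ℂ} (hy : ‖y‖ < 1) :
    ∑' k, (idealCount K (p ^ k) : ℂ) * y ^ k ≠ 0 := by
  have hne : ∀ {z : ℂ}, ‖z‖ < 1 → (1 - z)⁻¹ ≠ 0 := fun {z} hz => by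
    refine inv_ne_zero (sub_ne_zero.mpr ?_)
    rintro rfl
    simp at hz
  obtain ⟨h1, h2, h3⟩ := tsum_idealCount_prime_pow hd hd1 hδ hK hp hy
  rcases idealCount_prime_pow hd hd1 hδ hK hp with ⟨h, _⟩ | ⟨h, _⟩ | ⟨h, _⟩
  · rw [h1 h]
    exact hne (by rw [norm_pow]; exact pow_lt_one₀ (norm_nonneg _) hy two_ne_zero)
  · rw [h2 h]
    exact pow_ne_zero _ (hne hy)
  · rw [h3 h]
    exact hne hy

/-- The Cauchy product is taken at `y = p ^ (-s)`; the condition `‖p y‖ < 1` is `Re s > 1`. -/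
theorem localRepZeta_heisenberg (hd : Squarefree d) (hd1 : d ≠ 1) (hδ : δ ^ 2 = (d : K))
    (hK : IntermediateField.adjoin ℚ {δ} = ⊤) {p : ℕ} (hp : p.Prime) {s : ℂ} (hs : 1 < s.re) :
    Summable (localTerm (heisenberg (𝓞 K)) p s) ∧
      localRepZeta (heisenberg (𝓞 K)) p s =
        (∑' k, (idealCount K (p ^ k) : ℂ) * ((p : ℂ) ^ (1 - s)) ^ k) /
          ∑' k, (idealCount K (p ^ k) : ℂ) * ((p : ℂ) ^ (-s)) ^ k := by
  have hy : ‖(p : ℂ) ^ (-s)‖ < 1 := norm_natCast_cpow_neg_lt_one hp (by linarith)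
  have hpy : ‖(p : ℂ) * (p : ℂ) ^ (-s)‖ < 1 := by
    rw [natCast_mul_cpow_neg hp, ← neg_sub]
    exact norm_natCast_cpow_neg_lt_one hp (by simpa using hs)
  have hterm : localTerm (heisenberg (𝓞 K)) p s = fun k =>
      (numTwistIsoclasses (heisenberg (𝓞 K)) (p ^ k) : ℂ) * ((p : ℂ) ^ (-s)) ^ k := by
    ext k
    rw [localTerm, ← Complex.cpow_nat_mul, neg_mul, mul_neg]
  obtain ⟨h1, h2⟩ := local_factor_mul (p := p) (a := fun k => idealCount K (p ^ k))
    (r := fun k => numTwistIsoclasses (heisenberg (𝓞 K)) (p ^ k))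
    (by simp [idealCount_one]) (idealCount_prime_pow_le hd hd1 hδ hK hp)
    (sum_antidiagonal_numTwistIsoclasses K hp) hy hpy
  refine ⟨hterm ▸ h1, ?_⟩
  rw [eq_div_iff (tsum_idealCount_prime_pow_ne_zero hd hd1 hδ hK hp hy), localRepZeta, hterm, h2,
    natCast_mul_cpow_neg hp]

end LocalZeta

end HeisenbergZeta

namespace HeisenbergZeta

open NumberField Filter

/-! ### The global zeta function -/

section Global

variable (K : Type*) [Field K] [NumberField K]

/-- The Dedekind zeta function converges absolutely for `Re s > 1`. -/
theorem LSeriesSummable_idealCount {s : ℂ} (hs : 1 < s.re) :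
    LSeriesSummable (fun n => (idealCount K n : ℂ)) s := by
  have h : Tendsto (fun n : ℕ => (∑ k ∈ Finset.Icc 1 n, (idealCount K k : ℝ)) / n) atTop
      (nhds (dedekindZeta_residue K)) := by
    refine ((NumberField.Ideal.tendsto_norm_le_div_atTop₀ K).comp
      tendsto_natCast_atTop_atTop).congr fun n ↦ ?_
    simp only [Function.comp_apply, Nat.cast_le, ← Nat.cast_sum]
    congr
    -- The asymptotic concerns nonzero ideals. Adding the zero ideal to both sides lets all ideals
    -- of norm at most `n` be sorted by norm.
    rw [← add_left_inj 1, ← Ideal.card_norm_le_eq_card_norm_le_add_one,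
      show Finset.Icc 1 n = Finset.Ioc 0 n from Finset.Icc_succ_left_eq_Ioc _ _,
      ← idealCount_zero (K := K), Finset.sum_Ioc_add_eq_sum_Icc (n.zero_le)]
    simp only [idealCount]
    rw [← Finset.card_preimage_eq_sum_card_image_eq
        (fun k _ ↦ Ideal.finite_setOfPred_absNorm_eq k)]
    simp [Set.coe_eq_subtype]
  have hO : (fun n : ℕ => ∑ k ∈ Finset.Icc 1 n, (idealCount K k : ℝ)) =O[atTop]
      fun n => (n : ℝ) ^ (1 : ℝ) := by
    have h1 := (h.isBigO_one ℝ).mul (Asymptotics.isBigO_refl (fun n : ℕ => (n : ℝ)) atTop)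
    refine (h1.congr' ?_ ?_)
    · filter_upwards [eventually_ne_atTop 0] with n hn
      rw [div_mul_cancel₀ _ (by exact_mod_cast hn)]
    · filter_upwards with n
      simp
  have := LSeriesSummable_of_sum_norm_bigO_and_nonneg hO (fun n => Nat.cast_nonneg _) zero_le_one hs
  simpa using this

lemma term_natCast_mul (f : ℕ → ℂ) (s : ℂ) :
    LSeries.term (fun n => (n : ℂ) * f n) s = LSeries.term f (s - 1) := by
  ext n
  rcases eq_or_ne n 0 with rfl | hn
  · simp
  · have hn' : (n : ℂ) ≠ 0 := by exact_mod_cast hn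
    rw [LSeries.term_of_ne_zero hn, LSeries.term_of_ne_zero hn, Complex.cpow_sub _ _ hn',
      Complex.cpow_one]
    field_simp

lemma numTwistIsoclasses_le {n : ℕ} (hn : n ≠ 0) :
    numTwistIsoclasses (heisenberg (𝓞 K)) n ≤ n * idealCount K n := by
  rw [← sum_numTwistIsoclasses_mul_idealCount K hn]
  have := Finset.single_le_sum
    (f := fun x : ℕ × ℕ => numTwistIsoclasses (heisenberg (𝓞 K)) x.1 * idealCount K x.2)
    (fun _ _ => Nat.zero_le _)
    (show (n, 1) ∈ n.divisorsAntidiagonal by simp [hn])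
  simpa [idealCount_one] using this

theorem LSeriesSummable_numTwistIsoclasses {s : ℂ} (hs : 2 < s.re) :
    LSeriesSummable (fun n => (numTwistIsoclasses (heisenberg (𝓞 K)) n : ℂ)) s := by
  have h : LSeriesSummable (fun n => (n : ℂ) * (idealCount K n : ℂ)) s := by
    rw [LSeriesSummable, term_natCast_mul]
    refine LSeriesSummable_idealCount K ?_
    rw [Complex.sub_re, Complex.one_re]
    linarith
  refine Summable.of_norm_bounded h.norm fun n => ?_
  rcases eq_or_ne n 0 with rfl | hn
  · simp
  refine LSeries.norm_term_le s ?_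
  rw [← Nat.cast_mul, Complex.norm_natCast, Complex.norm_natCast]
  exact_mod_cast numTwistIsoclasses_le K hn

/-- The product of L-series is the L-series of the convolution, here `n a(n)`; the factor `n` shifts
`s` by one. -/
theorem repZeta_mul_dedekindZeta {s : ℂ} (hs : 2 < s.re) :
    repZeta (heisenberg (𝓞 K)) s * dedekindZeta K s = dedekindZeta K (s - 1) := by
  have h1 := LSeries_convolution' (LSeriesSummable_numTwistIsoclasses K hs)
    (LSeriesSummable_idealCount K (s := s) (by linarith))
  refine h1.symm.trans ?_
  have h2 : LSeries (fun n => (n : ℂ) * (idealCount K n : ℂ)) s = dedekindZeta K (s - 1) := by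
    rw [LSeries, term_natCast_mul]
    rfl
  rw [← h2]
  refine LSeries_congr (fun {n} hn => ?_) s
  rw [LSeries.convolution_def]
  have h3 := congrArg (Nat.cast (R := ℂ)) (sum_numTwistIsoclasses_mul_idealCount K hn)
  push_cast at h3
  exact h3

end Global

/-! ### Nonvanishing of the Dedekind zeta function -/

section Nonvanishing

variable {d : ℤ} {K : Type*} [Field K] [NumberField K] {δ : K}

/-- In the Euler product each factor is nonzero and has the form `1 + tail`. Summability of the
tails keeps the infinite product away from zero. -/
theorem dedekindZeta_ne_zero (hd : Squarefree d) (hd1 : d ≠ 1) (hδ : δ ^ 2 = (d : K))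
    (hK : IntermediateField.adjoin ℚ {δ} = ⊤) {s : ℂ} (hs : 1 < s.re) :
    dedekindZeta K s ≠ 0 := by
  set f : ℕ → ℂ := LSeries.term (fun n => (idealCount K n : ℂ)) s with hf
  have hsum : Summable fun n => ‖f n‖ := (LSeriesSummable_idealCount K hs).norm
  have hf0 : f 0 = 0 := LSeries.term_zero _ _
  have hf1 : f 1 = 1 := by simp [hf, LSeries.term_of_ne_zero, idealCount_one]
  have hmul : ∀ {m n : ℕ}, m.Coprime n → f (m * n) = f m * f n := by
    intro m n h
    rcases eq_or_ne m 0 with rfl | hm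
    · simp [hf0]
    rcases eq_or_ne n 0 with rfl | hn
    · simp [hf0]
    rw [hf, LSeries.term_of_ne_zero hm, LSeries.term_of_ne_zero hn,
      LSeries.term_of_ne_zero (mul_ne_zero hm hn), idealCount_mul h, Nat.cast_mul, Nat.cast_mul,
      Complex.natCast_mul_natCast_cpow, mul_div_mul_comm]
  have hpow : ∀ p : Nat.Primes, ∀ k, f (p ^ k) =
      (idealCount K (p ^ k) : ℂ) * (((p : ℕ) : ℂ) ^ (-s)) ^ k := by
    intro p k
    rw [hf, LSeries.term_of_ne_zero (pow_ne_zero k p.2.ne_zero), div_eq_mul_inv,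
      ← Complex.cpow_neg, Nat.cast_pow, ← Complex.cpow_nat_mul, Complex.natCast_cpow_natCast_mul]
  have hne : ∀ p : Nat.Primes, ∑' k, f (p ^ k) ≠ 0 := fun p => by
    simp only [hpow]
    exact tsum_idealCount_prime_pow_ne_zero hd hd1 hδ hK p.2
      (norm_natCast_cpow_neg_lt_one p.2 (by linarith))
  have hprod : ∏' p : Nat.Primes, ∑' k, f (p ^ k) = dedekindZeta K s :=
    EulerProduct.eulerProduct_tprod hf1 hmul hsum hf0
  -- By unique factorization `(p, k) ↦ p ^ (k + 1)` is injective, so this is a subfamily of an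
  -- absolutely convergent series.
  have hps : Summable fun x : Nat.Primes × ℕ => ‖f (x.1 ^ (x.2 + 1))‖ := by
    refine hsum.comp_injective (i := fun x : Nat.Primes × ℕ => (x.1 : ℕ) ^ (x.2 + 1)) ?_
    intro x y h
    exact Nat.Primes.prodNatEquiv.injective (Subtype.ext h)
  have htail : ∀ p : Nat.Primes, ∑' k, f (p ^ k) = 1 + ∑' k, f (p ^ (k + 1)) := fun p => by
    have : Summable fun k => f (p ^ k) :=
      hsum.of_norm.comp_injective (Nat.pow_right_injective p.2.two_le)
    rw [this.tsum_eq_zero_add, pow_zero, hf1]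
  rw [← hprod]
  simp only [htail] at hne ⊢
  refine tprod_one_add_ne_zero_of_summable hne ?_
  refine Summable.of_nonneg_of_le (fun p => norm_nonneg _) (fun p => ?_) hps.prod
  exact norm_tsum_le_tsum_norm (hps.prod_factor p)

end Nonvanishing

end HeisenbergZeta

theorem theorem1 (d : ℤ) (hd : Squarefree d) (hd1 : d ≠ 1)
    (K : Type*) [Field K] [NumberField K] (δ : K) (hδ : δ ^ 2 = (d : K))
    (hK : IntermediateField.adjoin ℚ {δ} = ⊤) :
    (∀ n : ℕ, Finite
      (HeisenbergZeta.TwistIsoclass (HeisenbergZeta.heisenberg (NumberField.RingOfIntegers K)) n)) ∧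
    (∀ p : ℕ, p.Prime → ∀ s : ℂ, 1 < s.re →
      Summable (HeisenbergZeta.localTerm
        (HeisenbergZeta.heisenberg (NumberField.RingOfIntegers K)) p s) ∧
      (HeisenbergZeta.IsInert d p →
        HeisenbergZeta.localRepZeta
          (HeisenbergZeta.heisenberg (NumberField.RingOfIntegers K)) p s =
          (1 - (p : ℂ) ^ (-2 * s)) / (1 - (p : ℂ) ^ (2 - 2 * s))) ∧
      (HeisenbergZeta.Splits d p →
        HeisenbergZeta.localRepZeta
          (HeisenbergZeta.heisenberg (NumberField.RingOfIntegers K)) p s =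
          ((1 - (p : ℂ) ^ (-s)) / (1 - (p : ℂ) ^ (1 - s))) ^ 2) ∧
      (HeisenbergZeta.IsRamified d p →
        HeisenbergZeta.localRepZeta
          (HeisenbergZeta.heisenberg (NumberField.RingOfIntegers K)) p s =
          (1 - (p : ℂ) ^ (-s)) / (1 - (p : ℂ) ^ (1 - s)))) ∧
    (∀ s : ℂ, 2 < s.re →
      LSeriesSummable (fun n => (HeisenbergZeta.numTwistIsoclasses
        (HeisenbergZeta.heisenberg (NumberField.RingOfIntegers K)) n : ℂ)) s ∧
      NumberField.dedekindZeta K s ≠ 0 ∧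
      HeisenbergZeta.repZeta (HeisenbergZeta.heisenberg (NumberField.RingOfIntegers K)) s =
        NumberField.dedekindZeta K (s - 1) / NumberField.dedekindZeta K s) := by
  refine ⟨HeisenbergZeta.finite_twistIsoclass K, fun p hp s hs => ?_, fun s hs => ?_⟩
  · obtain ⟨hsum, heq⟩ := HeisenbergZeta.localRepZeta_heisenberg hd hd1 hδ hK hp hs
    obtain ⟨i1, s1, r1⟩ := HeisenbergZeta.tsum_idealCount_prime_pow hd hd1 hδ hK hp
      (HeisenbergZeta.norm_natCast_cpow_neg_lt_one hp (s := s) (by linarith))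
    obtain ⟨i2, s2, r2⟩ := HeisenbergZeta.tsum_idealCount_prime_pow hd hd1 hδ hK hp
      (y := (p : ℂ) ^ (1 - s)) (by
        rw [← neg_sub]
        exact HeisenbergZeta.norm_natCast_cpow_neg_lt_one hp (by simpa using hs))
    rw [heq]
    refine ⟨hsum, fun h => ?_, fun h => ?_, fun h => ?_⟩
    · rw [i1 h, i2 h, ← Complex.cpow_nat_mul, ← Complex.cpow_nat_mul, inv_div_inv]
      congr 3 <;> push_cast <;> ring
    · rw [s1 h, s2 h, ← div_pow, inv_div_inv]
    · rw [r1 h, r2 h, inv_div_inv]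
  · have hne := HeisenbergZeta.dedekindZeta_ne_zero hd hd1 hδ hK (s := s) (by linarith)
    exact ⟨HeisenbergZeta.LSeriesSummable_numTwistIsoclasses K hs, hne,
      eq_div_of_mul_eq hne (HeisenbergZeta.repZeta_mul_dedekindZeta K hs)⟩
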